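/- Let $k$ be a field and let $\Lambda$ be a finite-dimensional Hopf algebra over $k$ which is basic and split and is not semisimple. (Split: $\operatorname{End}_\Lambda(S)=k$ for every simple $\Lambda$-module $S$. Basic: every simple module has multiplicity one in $\Lambda/\operatorname{rad}\Lambda$. Consequently all simple modules are one-dimensional.) Modules are finitely generated left modules, and $M\otimes N=M\otimes_k N$ is a $\Lambda$-module through the comultiplication. Let $\mathcal S$ be the group of isomorphism classes of simple $\Lambda$-modules under $\otimes$ (the structure group); its unit is the trivial module $k_\varepsilon$ and the inverse of $S$ is $S^*=\operatorname{Hom}_k(S,k)$. Let $P_1$ be the projective cover of $k_\varepsilon$, and let $c\in\mathbb Z\mathcal S$ be the sum of the classes of the factors of a composition series of $P_1$. Let $K_0(\Lambda)$ be the free abelian group on the isomorphism classes of finitely generated $\Lambda$-modules modulo the relations $[X_2]=[X_1]+[X_3]$ for all split exact sequences $0\to X_1\to X_2\to X_3\to 0$; it is a ring with the product induced by $\otimes$. Let $K_0^p(\Lambda)$ be the subring of $K_0(\Lambda)$ generated by the classes of projective modules and of semisimple modules. Assume that $\mathcal S$ is abelian, of order $s$, and let $r$ be the number of characters $\chi:\mathcal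 S\to\mathbb C^\times$ whose linear extension to $\mathbb Z\mathcal S$ does not vanish at $c$. Then $0<r\le s$, and there is an isomorphism of $\mathbb C$-algebras $$\mathbb C\otimes_{\mathbb Z}K_0^p(\Lambda)\;\cong\;\mathbb C^{2r}\times\mathbb C[\epsilon]^{\,s-r},$$ where $\mathbb C[\epsilon]=\mathbb C[X]/(X^2)$ is the algebra of dual numbers. -/

import Mathlib

open scoped TensorProduct

universe u

namespace ProjClass

/-- A finitely generated left module over the finite dimensional `k`-algebra `Λ`
(that is, a `Λ`-module that is finite dimensional over `k`). -/
structure FinMod (k Λ : Type u) [Field k] [Ring Λ] [Algebra k Λ] : Type (u + 1) where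
  carrier : Type u
  [addCommGroup : AddCommGroup carrier]
  [baseModule : Module k carrier]
  [module : Module Λ carrier]
  [isScalarTower : IsScalarTower k Λ carrier]
  [finite : Module.Finite k carrier]

namespace FinMod

attribute [instance] addCommGroup baseModule module isScalarTower finite

instance (k Λ : Type u) [Field k] [Ring Λ] [Algebra k Λ] : CoeSort (FinMod k Λ) (Type u) :=
  ⟨FinMod.carrier⟩

section Algebra

variable {k Λ : Type u} [Field k] [Ring Λ] [Algebra k Λ]

/-- Two modules are identified when there is a `Λ`-linear bijection between them. -/
instance setoid (k Λ : Type u) [Field k] [Ring Λ] [Algebra k Λ] : Setoid (FinMod k Λ) where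
  r M N := Nonempty (M ≃ₗ[Λ] N)
  iseqv := ⟨fun M => ⟨LinearEquiv.refl Λ M⟩, fun ⟨e⟩ => ⟨e.symm⟩, fun ⟨e⟩ ⟨f⟩ => ⟨e.trans f⟩⟩

/-- The direct sum of two modules. -/
def prod (M N : FinMod k Λ) : FinMod k Λ where
  carrier := M × N

/-- The module given by a vector space `V` and an algebra homomorphism `ρ : Λ → End_k V`. -/
def ofAction (V : Type u) [AddCommGroup V] [Module k V] [Module.Finite k V]
    (ρ : Λ →ₐ[k] Module.End k V) : FinMod k Λ :=
  letI : Module Λ V := Module.compHom V ρ.toRingHom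
  { carrier := V
    isScalarTower := ⟨fun c a v => by
      change ρ (c • a) v = c • ρ a v
      rw [map_smul]; rfl⟩ }

/-- The underlying vector space of `ofAction V ρ` is `V`. -/
def ofActionEquiv (V : Type u) [AddCommGroup V] [Module k V] [Module.Finite k V]
    (ρ : Λ →ₐ[k] Module.End k V) : V ≃ₗ[k] ofAction V ρ :=
  LinearEquiv.refl k V

lemma smul_ofActionEquiv (V : Type u) [AddCommGroup V] [Module k V] [Module.Finite k V]
    (ρ : Λ →ₐ[k] Module.End k V) (a : Λ) (v : V) :
    a • ofActionEquiv V ρ v = ofActionEquiv V ρ (ρ a v) := rfl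

/-- A `k`-linear bijection that commutes with the action of `Λ` is `Λ`-linear. -/
def equivOfAction {V : Type u} [AddCommGroup V] [Module k V] [Module.Finite k V]
    {ρ : Λ →ₐ[k] Module.End k V} {P : FinMod k Λ} (e : V ≃ₗ[k] P)
    (h : ∀ (a : Λ), e.toLinearMap ∘ₗ ρ a = Algebra.lsmul k k P a ∘ₗ e.toLinearMap) :
    ofAction V ρ ≃ₗ[Λ] P :=
  { (ofActionEquiv V ρ).symm.trans e with
    map_smul' := fun a v => LinearMap.congr_fun (h a) ((ofActionEquiv V ρ).symm v) }

/-- The subquotient `B / (A ∩ B)` of a module. -/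
def subquotient (M : FinMod k Λ) (A B : Submodule Λ M) : FinMod k Λ :=
  haveI : Module.Finite k B := inferInstanceAs (Module.Finite k (B.restrictScalars k))
  haveI := Module.Finite.quotient k (Submodule.comap B.subtype A)
  { carrier := B ⧸ Submodule.comap B.subtype A }

end Algebra

variable {k Λ : Type u} [Field k] [Ring Λ] [HopfAlgebra k Λ]

/-- The action of `Λ` on `M ⊗ N`: `a` acts as `∑ a₁ ⊗ a₂`, where `Δ a = ∑ a₁ ⊗ a₂`. -/
def tensorAction (M N : FinMod k Λ) : Λ →ₐ[k] Module.End k (M ⊗[k] N) :=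
  (Module.endTensorEndAlgHom (R := k) (S := k) (A := k) (M := M) (N := N)).comp
    ((Algebra.TensorProduct.map (Algebra.lsmul k k M) (Algebra.lsmul k k N)).comp
      (Bialgebra.comulAlgHom k Λ))

/-- The tensor product over `k` of two modules. -/
def tensor (M N : FinMod k Λ) : FinMod k Λ := ofAction (M ⊗[k] N) (tensorAction M N)

/-- The trivial module: `k`, with the action given by the counit. -/
def trivial (k Λ : Type u) [Field k] [Ring Λ] [HopfAlgebra k Λ] : FinMod k Λ :=
  ofAction k ((Algebra.lmul k k).comp (Bialgebra.counitAlgHom k Λ))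

/-- The action of `Λ` on `Hom_k(M, k)`: `(a • f) m = f (S(a) • m)`, where `S` is the antipode. -/
def dualAction (M : FinMod k Λ) : Λ →ₐ[k] Module.End k (Module.Dual k M) :=
  AlgHom.ofLinearMap
    (((Module.Dual.transpose (R := k) (M := M) (M' := M)).comp
        (Algebra.lsmul k k M).toLinearMap).comp (HopfAlgebra.antipode k (A := Λ)))
    (by ext f m; simp [Module.Dual.transpose_apply])
    (by intro a b; ext f m
        simp [HopfAlgebra.antipode_mul_antidistrib, Module.Dual.transpose_apply])

/-- The dual module. -/
def dual (M : FinMod k Λ) : FinMod k Λ := ofAction (Module.Dual k M) (dualAction M)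

lemma dualAction_apply (M : FinMod k Λ) (a : Λ) (f : Module.Dual k M) (m : M) :
    dualAction M a f m = f (HopfAlgebra.antipode k a • m) := rfl

lemma tensorAction_tmul (M N : FinMod k Λ) (a : Λ) (m : M) (n : N) :
    tensorAction M N a (m ⊗ₜ n) =
      ∑ i ∈ (Coalgebra.Repr.arbitrary k a).index,
        ((Coalgebra.Repr.arbitrary k a).left i • m) ⊗ₜ[k]
          ((Coalgebra.Repr.arbitrary k a).right i • n) := by
  change Module.endTensorEndAlgHom (R := k) (S := k) (A := k) (M := M) (N := N)
    (Algebra.TensorProduct.map (Algebra.lsmul k k M) (Algebra.lsmul k k N)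
      (Coalgebra.comul (R := k) a)) (m ⊗ₜ n) = _
  conv_lhs => rw [← (Coalgebra.Repr.arbitrary k a).eq]
  rw [map_sum, map_sum, LinearMap.sum_apply]
  rfl

/-- The underlying vector space of `M.tensor N` is `M ⊗[k] N`. -/
def toTensor (M N : FinMod k Λ) : (M ⊗[k] N) ≃ₗ[k] M.tensor N := ofActionEquiv _ _

/-- The underlying vector space of the trivial module is `k`. -/
def toTrivial (k Λ : Type u) [Field k] [Ring Λ] [HopfAlgebra k Λ] : k ≃ₗ[k] trivial k Λ :=
  ofActionEquiv _ _

/-- The underlying vector space of the dual module is the dual space. -/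
def toDual (M : FinMod k Λ) : Module.Dual k M ≃ₗ[k] M.dual := ofActionEquiv _ _

lemma smul_toTensor (M N : FinMod k Λ) (a : Λ) (t : M ⊗[k] N) :
    a • toTensor M N t = toTensor M N (tensorAction M N a t) := rfl

lemma smul_toTrivial (a : Λ) (c : k) :
    a • toTrivial k Λ c = toTrivial k Λ (Coalgebra.counit (R := k) a * c) := rfl

lemma smul_toDual (M : FinMod k Λ) (a : Λ) (f : Module.Dual k M) :
    a • toDual M f = toDual M (dualAction M a f) := rfl

/-- Equivariance of a linear map on a tensor product is checked on pure tensors. -/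
def tensorEquiv {M N P : FinMod k Λ} (e : (M ⊗[k] N) ≃ₗ[k] P)
    (h : ∀ (a : Λ) (m : M) (n : N), e (tensorAction M N a (m ⊗ₜ n)) = a • e (m ⊗ₜ n)) :
    M.tensor N ≃ₗ[Λ] P :=
  equivOfAction e fun a => TensorProduct.ext' (h a)

/-- The linear map `a ↦ a • m`. -/
def orb (M : FinMod k Λ) (m : M) : Λ →ₗ[k] M :=
  (LinearMap.toSpanSingleton Λ M m).restrictScalars k

lemma orb_apply (M : FinMod k Λ) (m : M) (a : Λ) : M.orb m a = a • m := rfl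

lemma tensorAction_tmul' (M N : FinMod k Λ) (a : Λ) (m : M) (n : N) :
    tensorAction M N a (m ⊗ₜ n) =
      TensorProduct.map (M.orb m) (N.orb n) (Coalgebra.comul (R := k) a) := by
  rw [tensorAction_tmul]
  conv_rhs => rw [← (Coalgebra.Repr.arbitrary k a).eq]
  rw [map_sum]
  rfl

lemma orb_toTensor (M N : FinMod k Λ) (m : M) (n : N) :
    (M.tensor N).orb (toTensor M N (m ⊗ₜ n)) =
      (toTensor M N).toLinearMap ∘ₗ
        TensorProduct.map (M.orb m) (N.orb n) ∘ₗ Coalgebra.comul := by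
  ext a
  exact congrArg (toTensor M N) (tensorAction_tmul' M N a m n)

/-- The tensor product respects isomorphism. -/
lemma tensor_congr {M M' N N' : FinMod k Λ} (e : M ≃ₗ[Λ] M') (f : N ≃ₗ[Λ] N') :
    Nonempty (M.tensor N ≃ₗ[Λ] M'.tensor N') := by
  refine ⟨tensorEquiv ((TensorProduct.congr (e.restrictScalars k) (f.restrictScalars k)).trans
    (toTensor M' N')) fun a m n => ?_⟩
  simp only [LinearEquiv.trans_apply, TensorProduct.congr_tmul, smul_toTensor, tensorAction_tmul,
    map_sum, LinearEquiv.restrictScalars_apply, map_smul]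

/-- Taking duals respects isomorphism. -/
lemma dual_congr {M M' : FinMod k Λ} (e : M ≃ₗ[Λ] M') : Nonempty (M.dual ≃ₗ[Λ] M'.dual) := by
  refine ⟨equivOfAction ((e.restrictScalars k).symm.dualMap.trans (toDual M')) fun a => ?_⟩
  refine LinearMap.ext fun f => congrArg (toDual M') (LinearMap.ext fun m => ?_)
  change f (HopfAlgebra.antipode k a • e.symm m) = f (e.symm (HopfAlgebra.antipode k a • m))
  rw [LinearEquiv.map_smul]

/-- The tensor product is associative. -/
lemma tensor_assoc (M N P : FinMod k Λ) :
    Nonempty ((M.tensor N).tensor P ≃ₗ[Λ] M.tensor (N.tensor P)) := by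
  refine ⟨tensorEquiv ((TensorProduct.congr (toTensor M N).symm (LinearEquiv.refl k P)).trans
    ((TensorProduct.assoc k M N P).trans ((TensorProduct.congr (LinearEquiv.refl k M)
      (toTensor N P)).trans (toTensor M (N.tensor P))))) fun a t p => ?_⟩
  obtain ⟨t, rfl⟩ := (toTensor M N).surjective t
  induction t with
  | zero => simp only [map_zero, TensorProduct.zero_tmul, smul_zero]
  | add x y hx hy =>
    simp only [map_add, TensorProduct.add_tmul, smul_add] at hx hy ⊢
    rw [hx, hy]
  | tmul m n =>
    simp only [LinearEquiv.trans_apply, TensorProduct.congr_tmul, LinearEquiv.symm_apply_apply,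
      LinearEquiv.refl_apply, TensorProduct.assoc_tmul, smul_toTensor]
    refine congrArg (toTensor M (N.tensor P)) ?_
    rw [tensorAction_tmul', tensorAction_tmul', orb_toTensor, orb_toTensor]
    have h := congrArg (TensorProduct.map (M.orb m) ((toTensor N P).toLinearMap ∘ₗ
      TensorProduct.map (N.orb n) (P.orb p))) (Coalgebra.coassoc_apply (R := k) a)
    have key : ∀ z : Λ ⊗[k] Λ, TensorProduct.map (M.orb m) ((toTensor N P).toLinearMap ∘ₗ
        TensorProduct.map (N.orb n) (P.orb p)) (Coalgebra.comul.lTensor Λ z) =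
        TensorProduct.map (M.orb m) ((toTensor N P).toLinearMap ∘ₗ
          TensorProduct.map (N.orb n) (P.orb p) ∘ₗ Coalgebra.comul) z := by
      intro z
      induction z with
      | zero => simp
      | add x y hx hy => simp only [map_add, hx, hy]
      | tmul x y => simp
    rw [← key, ← h]
    induction Coalgebra.comul (R := k) a with
    | zero => simp
    | add x y hx hy => simp only [map_add, hx, hy]
    | tmul x y =>
      simp only [TensorProduct.map_tmul, LinearMap.comp_apply, LinearEquiv.coe_coe,
        TensorProduct.congr_tmul, LinearEquiv.symm_apply_apply, LinearMap.rTensor_tmul,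
        LinearEquiv.refl_apply]
      induction Coalgebra.comul (R := k) x with
      | zero => simp
      | add x y hx hy => simp only [map_add, TensorProduct.add_tmul, hx, hy]
      | tmul z w => simp

/-- The trivial module is a left unit. -/
lemma trivial_tensor (M : FinMod k Λ) : Nonempty ((trivial k Λ).tensor M ≃ₗ[Λ] M) := by
  refine ⟨tensorEquiv ((TensorProduct.congr (toTrivial k Λ).symm (LinearEquiv.refl k M)).trans
    (TensorProduct.lid k M)) fun a c m => ?_⟩
  obtain ⟨c, rfl⟩ := (toTrivial k Λ).surjective c
  rw [tensorAction_tmul]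
  simp only [map_sum, smul_toTrivial, LinearEquiv.trans_apply, TensorProduct.congr_tmul,
    LinearEquiv.symm_apply_apply, LinearEquiv.refl_apply, TensorProduct.lid_tmul]
  conv_rhs => rw [← Coalgebra.sum_counit_smul (Coalgebra.Repr.arbitrary k a)]
  rw [Finset.sum_smul]
  refine Finset.sum_congr rfl fun i _ => ?_
  rw [smul_assoc, smul_comm _ c m, smul_comm _ c, mul_smul, smul_comm _ c]

/-- The trivial module is a right unit. -/
lemma tensor_trivial (M : FinMod k Λ) : Nonempty (M.tensor (trivial k Λ) ≃ₗ[Λ] M) := by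
  refine ⟨tensorEquiv ((TensorProduct.congr (LinearEquiv.refl k M) (toTrivial k Λ).symm).trans
    (TensorProduct.rid k M)) fun a m c => ?_⟩
  obtain ⟨c, rfl⟩ := (toTrivial k Λ).surjective c
  rw [tensorAction_tmul]
  simp only [map_sum, smul_toTrivial, LinearEquiv.trans_apply, TensorProduct.congr_tmul,
    LinearEquiv.symm_apply_apply, LinearEquiv.refl_apply, TensorProduct.rid_tmul]
  have h := congrArg (TensorProduct.rid k Λ)
    (Coalgebra.sum_tmul_counit_eq (Coalgebra.Repr.arbitrary k a))
  simp only [map_sum, TensorProduct.rid_tmul, one_smul] at h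
  conv_rhs => rw [← h]
  rw [Finset.sum_smul]
  refine Finset.sum_congr rfl fun i _ => ?_
  rw [smul_assoc, smul_comm _ c m, mul_smul]

/-- The tensor product distributes over direct sums on the right. -/
lemma tensor_prod (M N P : FinMod k Λ) :
    Nonempty (M.tensor (N.prod P) ≃ₗ[Λ] (M.tensor N).prod (M.tensor P)) := by
  let E : (M ⊗[k] (N × P)) ≃ₗ[k] (M.tensor N × M.tensor P) :=
    (TensorProduct.prodRight k k M N P).trans
      (LinearEquiv.prodCongr (toTensor M N) (toTensor M P))
  have hE : ∀ (m : M) (n : N) (p : P),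
      E (m ⊗ₜ (n, p)) = (toTensor M N (m ⊗ₜ n), toTensor M P (m ⊗ₜ p)) := fun _ _ _ => rfl
  refine ⟨tensorEquiv (P := (M.tensor N).prod (M.tensor P)) E fun a m np => ?_⟩
  obtain ⟨n, p⟩ := np
  refine (congrArg E (tensorAction_tmul M (N.prod P) a m (n, p))).trans ?_
  refine (map_sum E _ _).trans ?_
  refine Eq.trans ?_ (Prod.ext (congrArg (toTensor M N) (tensorAction_tmul M N a m n).symm)
    (congrArg (toTensor M P) (tensorAction_tmul M P a m p).symm) :
      ((_, _) : M.tensor N × M.tensor P) = _)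
  rw [map_sum, map_sum]
  exact (Finset.sum_congr rfl fun i _ => hE _ _ _).trans (prod_mk_sum _ _ _).symm

/-- The tensor product distributes over direct sums on the left. -/
lemma prod_tensor (M N P : FinMod k Λ) :
    Nonempty ((M.prod N).tensor P ≃ₗ[Λ] (M.tensor P).prod (N.tensor P)) := by
  let E : ((M × N) ⊗[k] P) ≃ₗ[k] (M.tensor P × N.tensor P) :=
    (TensorProduct.prodLeft k k M N P).trans
      (LinearEquiv.prodCongr (toTensor M P) (toTensor N P))
  have hE : ∀ (m : M) (n : N) (p : P),
      E ((m, n) ⊗ₜ p) = (toTensor M P (m ⊗ₜ p), toTensor N P (n ⊗ₜ p)) := fun _ _ _ => rfl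
  refine ⟨tensorEquiv (P := (M.tensor P).prod (N.tensor P)) E fun a mn p => ?_⟩
  obtain ⟨m, n⟩ := mn
  refine (congrArg E (tensorAction_tmul (M.prod N) P a (m, n) p)).trans ?_
  refine (map_sum E _ _).trans ?_
  refine Eq.trans ?_ (Prod.ext (congrArg (toTensor M P) (tensorAction_tmul M P a m p).symm)
    (congrArg (toTensor N P) (tensorAction_tmul N P a n p).symm) :
      ((_, _) : M.tensor P × N.tensor P) = _)
  rw [map_sum, map_sum]
  exact (Finset.sum_congr rfl fun i _ => hE _ _ _).trans (prod_mk_sum _ _ _).symm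

/-- The evaluation `M* ⊗ M → k` is an isomorphism when `M` is one-dimensional. -/
lemma dual_tensor (M : FinMod k Λ) (hM : Module.finrank k M = 1) :
    Nonempty (M.dual.tensor M ≃ₗ[Λ] trivial k Λ) := by
  let F : (M.dual ⊗[k] M) →ₗ[k] k :=
    contractLeft k M ∘ₗ (TensorProduct.congr (toDual M).symm (LinearEquiv.refl k M)).toLinearMap
  have hF : ∀ f m, F (toDual M f ⊗ₜ m) = f m := fun _ _ => rfl
  have hs : Function.Surjective F := by
    have : Nontrivial M := Module.nontrivial_of_finrank_pos (R := k) (by omega)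
    obtain ⟨m, hm⟩ := exists_ne (0 : M)
    obtain ⟨f, hf⟩ : ∃ f : Module.Dual k M, f m ≠ 0 := by
      by_contra! h
      exact hm ((Module.forall_dual_apply_eq_zero_iff k m).mp h)
    intro c
    refine ⟨toDual M (c • (f m)⁻¹ • f) ⊗ₜ m, ?_⟩
    rw [hF]
    simp [hf]
  have hd : Module.finrank k (M.dual ⊗[k] M) = 1 := by
    rw [Module.finrank_tensorProduct, hM, ← (toDual M).finrank_eq, Subspace.dual_finrank_eq, hM]
  have hb : Function.Bijective F := by
    refine ⟨?_, hs⟩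
    rw [LinearMap.injective_iff_surjective_of_finrank_eq_finrank (by rw [hd]; simp)]
    exact hs
  refine ⟨tensorEquiv ((LinearEquiv.ofBijective F hb).trans (toTrivial k Λ)) fun a f m => ?_⟩
  obtain ⟨f, rfl⟩ := (toDual M).surjective f
  rw [LinearEquiv.trans_apply, LinearEquiv.trans_apply, smul_toTrivial]
  refine congrArg (toTrivial k Λ) ?_
  change F _ = _ * F _
  rw [tensorAction_tmul, map_sum, hF]
  simp only [smul_toDual, hF, dualAction_apply]
  rw [← map_sum, ← smul_eq_mul, ← map_smul]
  have h := congrArg (fun x => x • m)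
    (HopfAlgebra.sum_antipode_mul_eq_smul (Coalgebra.Repr.arbitrary k a))
  simp only [Finset.sum_smul, mul_smul, smul_assoc, one_smul] at h
  rw [h]

end FinMod

section Classes

variable (k Λ : Type u) [Field k] [Ring Λ]

/-- `Λ` is split: the endomorphism ring of each simple module is the ground field. -/
class IsSplit [Algebra k Λ] : Prop where
  bijective : ∀ S : FinMod k Λ, IsSimpleModule Λ S →
    Function.Bijective (algebraMap k (Module.End Λ S))

/-- `Λ` is basic: each simple module has multiplicity one in the maximal semisimple quotient
`Λ / rad Λ`, that is, its isotypic component in `Λ / rad Λ` is a single copy of it. -/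
class IsBasic [Algebra k Λ] : Prop where
  multiplicity_one : ∀ S : FinMod k Λ, IsSimpleModule Λ S →
    Nonempty (isotypicComponent Λ (Λ ⧸ Ring.jacobson Λ) S ≃ₗ[Λ] S)

end Classes

section Algebra

variable {k Λ : Type u} [Field k] [Ring Λ] [Algebra k Λ]

lemma FinMod.isNoetherian (M : FinMod k Λ) : IsNoetherian Λ M :=
  isNoetherian_of_tower k inferInstance

lemma FinMod.isArtinian (M : FinMod k Λ) : IsArtinian Λ M :=
  isArtinian_of_tower k inferInstance

lemma isSimpleModule_of_finrank (M : FinMod k Λ) (h : Module.finrank k M = 1) :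
    IsSimpleModule Λ M :=
  (isSimpleModule_iff Λ M).mpr (is_simple_module_of_finrank_eq_one h)

/-- The simple modules of a basic and split algebra are one-dimensional. -/
lemma finrank_eq_one [Module.Finite k Λ] [IsSplit k Λ] [IsBasic k Λ] (S : FinMod k Λ)
    (hS : IsSimpleModule Λ S) : Module.finrank k S = 1 := by
  have : IsArtinianRing Λ := IsArtinianRing.of_finite k Λ
  have : IsSemisimpleModule Λ (Λ ⧸ Ring.jacobson Λ) :=
    (IsArtinian.isSemisimpleModule_iff_jacobson Λ _).mpr
      (Module.jacobson_quotient_jacobson Λ Λ)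
  obtain ⟨e⟩ := IsBasic.multiplicity_one (k := k) S hS
  have hbij := (IsSplit.bijective (k := k) S hS).2
  let φ : S → ((Λ ⧸ Ring.jacobson Λ) →ₗ[Λ] S) := fun s =>
    (Ring.jacobson Λ).liftQ (LinearMap.toSpanSingleton Λ S s)
      (IsSemisimpleModule.jacobson_le_ker _ _ _ _ _)
  have hφ : ∀ s a, φ s (Submodule.Quotient.mk a) = a • s := fun _ _ => rfl
  have key : ∀ s : S, (∀ y : isotypicComponent Λ (Λ ⧸ Ring.jacobson Λ) S, φ s y = 0) → s = 0 := by
    intro s hs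
    by_contra hne
    have hsurj : Function.Surjective (φ s) := by
      refine LinearMap.surjective_of_ne_zero fun h => hne ?_
      have := hφ s 1
      rw [h, one_smul] at this
      exact this.symm
    obtain ⟨σ, hσ⟩ := IsSemisimpleModule.lifting_property (φ s) hsurj LinearMap.id
    have hinj : Function.Injective σ := by
      intro x y hxy
      have hx := LinearMap.congr_fun hσ x
      have hy := LinearMap.congr_fun hσ y
      simp only [LinearMap.comp_apply, LinearMap.id_apply] at hx hy
      rw [← hx, ← hy, hxy]
    have hle : LinearMap.range σ ≤ isotypicComponent Λ (Λ ⧸ Ring.jacobson Λ) S :=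
      le_sSup ⟨(LinearEquiv.ofInjective σ hinj).symm⟩
    have h0 := hs ⟨σ s, hle ⟨s, rfl⟩⟩
    have h1 := LinearMap.congr_fun hσ s
    simp only [LinearMap.comp_apply, LinearMap.id_apply] at h1
    exact hne (h1.symm.trans h0)
  let g : S → Module.End Λ S := fun s => φ s ∘ₗ Submodule.subtype _ ∘ₗ e.symm.toLinearMap
  have hg : ∀ s, ∃ c : k, ∀ y : isotypicComponent Λ (Λ ⧸ Ring.jacobson Λ) S,
      φ s y = c • e y := by
    intro s
    obtain ⟨c, hc⟩ := hbij (g s)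
    refine ⟨c, fun y => ?_⟩
    have := LinearMap.congr_fun hc (e y)
    simp only [g, LinearMap.comp_apply, LinearEquiv.coe_coe, LinearEquiv.symm_apply_apply] at this
    exact this.symm
  have := IsSimpleModule.nontrivial Λ S
  obtain ⟨s₀, hs₀⟩ := exists_ne (0 : S)
  obtain ⟨c₀, hc₀⟩ := hg s₀
  have hc₀ne : c₀ ≠ 0 := by
    rintro rfl
    exact hs₀ (key s₀ fun y => by rw [hc₀, zero_smul])
  refine _root_.finrank_eq_one s₀ hs₀ fun s => ?_
  obtain ⟨c, hc⟩ := hg s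
  refine ⟨c * c₀⁻¹, (sub_eq_zero.mp (key (s - (c * c₀⁻¹) • s₀) fun y => ?_)).symm⟩
  obtain ⟨y, hy⟩ := y
  obtain ⟨a, rfl⟩ := Submodule.Quotient.mk_surjective _ y
  have h1 := hc ⟨_, hy⟩
  have h2 := hc₀ ⟨_, hy⟩
  simp only [hφ] at h1 h2 ⊢
  rw [smul_sub, smul_comm, h1, h2, smul_smul, mul_assoc, inv_mul_cancel₀ hc₀ne, mul_one, sub_self]

/-- `P` is a projective cover of `M`: it is projective and there is an essential surjection
`ψ : P → M`, that is, no proper submodule of `P` is mapped onto `M`. -/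
def IsProjectiveCover (P M : FinMod k Λ) : Prop :=
  Module.Projective Λ P ∧ ∃ ψ : P →ₗ[Λ] M, Function.Surjective ψ ∧
    ∀ X : Submodule Λ P, X ≠ ⊤ → ¬ Function.Surjective (ψ.domRestrict X)

/-- Projective covers exist. -/
lemma exists_isProjectiveCover [Module.Finite k Λ] (M : FinMod k Λ) :
    ∃ P : FinMod k Λ, IsProjectiveCover P M := by
  classical
  have hex : ∃ n : ℕ, ∃ P : FinMod k Λ, Module.Projective Λ P ∧
      (∃ ψ : P →ₗ[Λ] M, Function.Surjective ψ) ∧ Module.finrank k P = n := by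
    have : Module.Finite Λ M := Module.Finite.of_restrictScalars_finite k Λ M
    obtain ⟨n, f, hf⟩ := Module.Finite.exists_fin' Λ M
    exact ⟨_, { carrier := Fin n → Λ }, inferInstanceAs (Module.Projective Λ (Fin n → Λ)),
      ⟨f, hf⟩, rfl⟩
  obtain ⟨P, hP, ⟨ψ, hψ⟩, hn⟩ := Nat.find_spec hex
  refine ⟨P, hP, ψ, hψ, fun X hX hs => hX ?_⟩
  obtain ⟨g, hg⟩ := Module.projective_lifting_property (ψ.domRestrict X) ψ hs
  let h : Module.End Λ P := X.subtype ∘ₗ g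
  have hh : ∀ p, ψ (h p) = ψ p := fun p => LinearMap.congr_fun hg p
  have hpow : ∀ n p, ψ ((h ^ n) p) = ψ p := by
    intro n
    induction n with
    | zero => intro p; simp
    | succ n ih => intro p; rw [pow_succ', Module.End.mul_apply, hh, ih]
  have := P.isNoetherian
  have := P.isArtinian
  obtain ⟨n, hc, hn1⟩ := ((LinearMap.eventually_isCompl_ker_pow_range_pow h).and
    (Filter.eventually_ge_atTop 1)).exists
  let R : Submodule Λ P := LinearMap.range (h ^ n)
  have hRf : Module.Finite k R := inferInstanceAs (Module.Finite k (R.restrictScalars k))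
  have hRp : Module.Projective Λ R :=
    Module.Projective.of_split R.subtype (Submodule.projectionOnto _ _ hc.symm)
      (LinearMap.ext fun x => Submodule.projectionOnto_apply_left hc.symm x)
  have hmin := Nat.find_min' hex
    ⟨{ carrier := R }, hRp, ⟨ψ ∘ₗ R.subtype, fun m => by
      obtain ⟨p, rfl⟩ := hψ m
      exact ⟨⟨(h ^ n) p, ⟨p, rfl⟩⟩, hpow n p⟩⟩, rfl⟩
  rw [← hn] at hmin
  have htop : R.restrictScalars k = ⊤ :=
    Submodule.eq_top_of_finrank_eq (le_antisymm (Submodule.finrank_le _) hmin)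
  rw [eq_top_iff]
  intro p _
  have hp : p ∈ R.restrictScalars k := htop ▸ Submodule.mem_top
  obtain ⟨q, rfl⟩ := hp
  obtain ⟨m, rfl⟩ := Nat.exists_eq_add_of_le hn1
  rw [pow_add, pow_one, Module.End.mul_apply]
  exact (g _).2

/-- The projective cover of a module (unique up to isomorphism). -/
noncomputable def projectiveCover [Module.Finite k Λ] (M : FinMod k Λ) : FinMod k Λ :=
  (exists_isProjectiveCover M).choose

lemma exists_compositionSeries (M : FinMod k Λ) :
    ∃ s : CompositionSeries (Submodule Λ M), s.head = ⊥ ∧ s.last = ⊤ :=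
  haveI := M.isNoetherian
  haveI := M.isArtinian
  exists_compositionSeries_of_isNoetherian_isArtinian Λ M

/-- A composition series of a module (by Jordan-Hölder, its factors do not depend on the choice
up to isomorphism and order). -/
noncomputable def compositionSeries (M : FinMod k Λ) : CompositionSeries (Submodule Λ M) :=
  (exists_compositionSeries M).choose

/-- The factors of the composition series of a module. -/
noncomputable def factor (M : FinMod k Λ) (i : Fin (compositionSeries M).length) : FinMod k Λ :=
  M.subquotient (compositionSeries M i.castSucc) (compositionSeries M i.succ)

lemma isSimpleModule_factor (M : FinMod k Λ) (i : Fin (compositionSeries M).length) :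
    IsSimpleModule Λ (factor M i) :=
  have h : compositionSeries M i.castSucc ⋖ compositionSeries M i.succ :=
    (compositionSeries M).step i
  (covBy_iff_quot_is_simple h.le).mp h

end Algebra

section Hopf

variable (k Λ : Type u) [Field k] [Ring Λ] [HopfAlgebra k Λ]

/-- The isomorphism classes of finitely generated `Λ`-modules. -/
def IsoClass : Type (u + 1) := Quotient (FinMod.setoid k Λ)

variable {k Λ} in
/-- The isomorphism class of a module. -/
def cls (M : FinMod k Λ) : IsoClass k Λ := Quotient.mk _ M

lemma cls_eq {M N : FinMod k Λ} (h : Nonempty (M ≃ₗ[Λ] N)) : cls M = cls N := Quotient.sound h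

/-- Isomorphism classes are multiplied by the tensor product of modules. -/
instance : Monoid (IsoClass k Λ) where
  mul x y := Quotient.liftOn₂ x y (fun M N => cls (M.tensor N))
    fun _ _ _ _ ⟨e⟩ ⟨f⟩ => cls_eq k Λ (FinMod.tensor_congr e f)
  one := cls (FinMod.trivial k Λ)
  mul_assoc := by
    rintro ⟨M⟩ ⟨N⟩ ⟨P⟩
    exact cls_eq k Λ (FinMod.tensor_assoc M N P)
  one_mul := by
    rintro ⟨M⟩
    exact cls_eq k Λ (FinMod.trivial_tensor M)
  mul_one := by
    rintro ⟨M⟩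
    exact cls_eq k Λ (FinMod.tensor_trivial M)

lemma cls_mul (M N : FinMod k Λ) : cls M * cls N = cls (M.tensor N) := rfl

/-- The set of isomorphism classes of simple modules. -/
def StructureGroup : Type (u + 1) :=
  {x : IsoClass k Λ // ∃ S : FinMod k Λ, IsSimpleModule Λ S ∧ cls S = x}

/-- The isomorphism classes of simple modules over a finite dimensional basic and split Hopf
algebra form a group under the tensor product; the inverse is given by the dual module. -/
noncomputable instance [Module.Finite k Λ] [IsSplit k Λ] [IsBasic k Λ] :
    Group (StructureGroup k Λ) :=
  letI : Mul (StructureGroup k Λ) := ⟨fun x y => ⟨x.1 * y.1, by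
    obtain ⟨_, S, hS, rfl⟩ := x
    obtain ⟨_, T, hT, rfl⟩ := y
    refine ⟨S.tensor T, isSimpleModule_of_finrank _ ?_, rfl⟩
    rw [← (FinMod.toTensor S T).finrank_eq, Module.finrank_tensorProduct,
      finrank_eq_one S hS, finrank_eq_one T hT]⟩⟩
  letI : One (StructureGroup k Λ) := ⟨⟨1, FinMod.trivial k Λ, isSimpleModule_of_finrank _ (by
    rw [← (FinMod.toTrivial k Λ).finrank_eq, Module.finrank_self]), rfl⟩⟩
  letI : Inv (StructureGroup k Λ) := ⟨fun x =>
    ⟨Quotient.liftOn x.1 (fun M => cls M.dual)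
      fun _ _ ⟨e⟩ => cls_eq k Λ (FinMod.dual_congr e), by
      obtain ⟨_, S, hS, rfl⟩ := x
      refine ⟨S.dual, isSimpleModule_of_finrank _ ?_, rfl⟩
      rw [← (FinMod.toDual S).finrank_eq, Subspace.dual_finrank_eq, finrank_eq_one S hS]⟩⟩
  Group.ofLeftAxioms
    (fun x y z => Subtype.ext (mul_assoc x.1 y.1 z.1))
    (fun x => Subtype.ext (one_mul x.1))
    (by
      rintro ⟨_, S, hS, rfl⟩
      exact Subtype.ext (cls_eq k Λ (FinMod.dual_tensor S (finrank_eq_one S hS))))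

variable {k Λ} in
/-- The sum of the composition factors of a module, in the integral group ring of the structure
group. -/
noncomputable def compositionClass [Module.Finite k Λ] [IsSplit k Λ] [IsBasic k Λ]
    (M : FinMod k Λ) : MonoidAlgebra ℤ (StructureGroup k Λ) :=
  ∑ i, MonoidAlgebra.of ℤ (StructureGroup k Λ)
    ⟨cls (factor M i), factor M i, isSimpleModule_factor M i, rfl⟩

/-- The canonical element `c`: the composition factors of the projective cover of the trivial
module. -/
noncomputable def canonicalElement [Module.Finite k Λ] [IsSplit k Λ] [IsBasic k Λ] :
    MonoidAlgebra ℤ (StructureGroup k Λ) :=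
  compositionClass (projectiveCover (FinMod.trivial k Λ))

/-- The value at `z` of the linear extension to the group ring of a character `χ`. -/
noncomputable def charValue {G : Type*} [Group G] (χ : G →* ℂˣ) (z : MonoidAlgebra ℤ G) : ℂ :=
  MonoidAlgebra.lift ℤ ℂ G ((Units.coeHom ℂ).comp χ) z

/-- The number of characters of the structure group that do not vanish at the canonical
element. -/
noncomputable def numNonvanishing [Module.Finite k Λ] [IsSplit k Λ] [IsBasic k Λ] : ℕ :=
  Nat.card {χ : StructureGroup k Λ →* ℂˣ // charValue χ (canonicalElement k Λ) ≠ 0}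

/-- The subgroup of the free abelian group on isomorphism classes generated by the elements
`[X ⊕ Y] - [X] - [Y]` (the relations given by the split exact sequences). -/
def splitRelations : AddSubgroup (FreeAbelianGroup (IsoClass k Λ)) :=
  AddSubgroup.closure {z | ∃ X Y : FinMod k Λ,
    z = FreeAbelianGroup.of (cls (X.prod Y)) - FreeAbelianGroup.of (cls X) -
      FreeAbelianGroup.of (cls Y)}

lemma mul_mem_splitRelations (x : FreeAbelianGroup (IsoClass k Λ))
    {y : FreeAbelianGroup (IsoClass k Λ)} (hy : y ∈ splitRelations k Λ) :
    x * y ∈ splitRelations k Λ := by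
  induction x using FreeAbelianGroup.induction_on with
  | zero => rw [zero_mul]; exact zero_mem _
  | neg a ih => rw [neg_mul]; exact neg_mem ih
  | add a b iha ihb => rw [add_mul]; exact add_mem iha ihb
  | of a =>
    induction hy using AddSubgroup.closure_induction with
    | zero => rw [mul_zero]; exact zero_mem _
    | add a b _ _ iha ihb => rw [mul_add]; exact add_mem iha ihb
    | neg a _ ih => rw [mul_neg]; exact neg_mem ih
    | mem z hz =>
      obtain ⟨X, Y, rfl⟩ := hz
      obtain ⟨W⟩ := a
      change FreeAbelianGroup.of (cls W) * _ ∈ _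
      refine AddSubgroup.subset_closure ⟨W.tensor X, W.tensor Y, ?_⟩
      simp only [mul_sub, ← FreeAbelianGroup.of_mul, cls_mul]
      rw [cls_eq k Λ (FinMod.tensor_prod W X Y)]

lemma mem_splitRelations_mul {x : FreeAbelianGroup (IsoClass k Λ)}
    (y : FreeAbelianGroup (IsoClass k Λ)) (hx : x ∈ splitRelations k Λ) :
    x * y ∈ splitRelations k Λ := by
  induction y using FreeAbelianGroup.induction_on with
  | zero => rw [mul_zero]; exact zero_mem _
  | neg a ih => rw [mul_neg]; exact neg_mem ih
  | add a b iha ihb => rw [mul_add]; exact add_mem iha ihb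
  | of a =>
    induction hx using AddSubgroup.closure_induction with
    | zero => rw [zero_mul]; exact zero_mem _
    | add a b _ _ iha ihb => rw [add_mul]; exact add_mem iha ihb
    | neg a _ ih => rw [neg_mul]; exact neg_mem ih
    | mem z hz =>
      obtain ⟨X, Y, rfl⟩ := hz
      obtain ⟨W⟩ := a
      change _ * FreeAbelianGroup.of (cls W) ∈ _
      refine AddSubgroup.subset_closure ⟨X.tensor W, Y.tensor W, ?_⟩
      simp only [sub_mul, ← FreeAbelianGroup.of_mul, cls_mul]
      rw [cls_eq k Λ (FinMod.prod_tensor X Y W)]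

/-- The subgroup of split relations, as a two-sided ideal. -/
def splitIdeal : TwoSidedIdeal (FreeAbelianGroup (IsoClass k Λ)) :=
  TwoSidedIdeal.mk' (splitRelations k Λ) (zero_mem _) add_mem neg_mem
    (mul_mem_splitRelations k Λ _) (mem_splitRelations_mul k Λ _)

/-- The Grothendieck ring `K₀(Λ)` of finitely generated modules, with respect to split exact
sequences; the product is induced by the tensor product. -/
abbrev K0 : Type (u + 1) := (splitIdeal k Λ).ringCon.Quotient

variable {k Λ} in
/-- The class `[M]` of a module in `K₀(Λ)`. -/
def K0.mk (M : FinMod k Λ) : K0 k Λ :=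
  (splitIdeal k Λ).ringCon.mk' (FreeAbelianGroup.of (cls M))

/-- The projective class ring: the subring of `K₀(Λ)` generated by the projective modules and the
semisimple modules. -/
def K0p : Subring (K0 k Λ) :=
  Subring.closure {x | ∃ M : FinMod k Λ,
    (Module.Projective Λ M ∨ IsSemisimpleModule Λ M) ∧ x = K0.mk M}

end Hopf

end ProjClass

/-! Write $p=[P_1]$. The plan is to show that $K_0^p(\Lambda)$ is the quadratic extension $\mathbb
Z\mathcal S[p]/(p^2-cp)$ of the group ring, and then to complexify.

Simple modules are one-dimensional, hence invertible under $\otimes$, so tensoring with one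
preserves projectivity. A comparison of dimensions gives $S\otimes P_1\cong P_S\cong P_1\otimes S$,
where $P_S$ is the projective cover of $S$; thus $p$ commutes with every $[S]$
(`projOne_mul_simpleClass`). Filter the left factor of $P_1\otimes P_1$ by a composition series. The
quotients $S_i\otimes P_1$ are projective, so the filtration splits, and $p^2=cp$ already holds for
split relations (`projOne_mul_projOne`). Every projective module is a sum of modules $P_S$ and every
semisimple module a sum of simple ones, so the elements $[S]$ and $[S]p=[P_S]$ span
(`span_basisFun`).

These elements are also independent (`linearIndependent_basisFun`). For simple $T$, the dimension of
$\operatorname{Hom}(M,T)$ and that of its subspace of maps vanishing on the image of every $T\to M$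
are additive in $M$. Both equal $\delta_{ST}$ at $P_S$; at $S$ the first is $\delta_{ST}$ and the
second is $0$. This is where non-semisimplicity enters: it implies that no simple module is
projective.

For finite abelian $\mathcal S$, $\mathbb C\mathcal S$ is a product of copies of $\mathbb C$ indexed
by the characters $\chi$, and the factor at $\chi$ of the extension is $\mathbb
C[X]/(X^2-\chi(c)X)$. This is $\mathbb C^2$ if $\chi(c)\ne0$ and the dual numbers if $\chi(c)=0$
(`nonempty_algEquiv_of_basis`). The trivial character sends $c$ to the length of $P_1$, whence
$r>0$. -/

namespace ProjClass

/-! ### Complexification of a quadratic extension of a group ring -/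

section GroupRing

variable {G R : Type*} [CommGroup G] [Ring R]

/-- A `ℤ`-algebra that is free on the elements `σ g` and `σ g * p`, where `p` is central and
`p * p = σ c * p`, maps to a commutative `ℂ`-algebra `D` as soon as a character `ρ` of `G` and an
element `d` of `D` with `d * d = ρ c * d` are given. -/
noncomputable def twistHom (σ : G →* R) (p : R) (c : MonoidAlgebra ℤ G)
    (hcomm : ∀ g, p * σ g = σ g * p) (hsq : p * p = MonoidAlgebra.lift ℤ R G σ c * p)
    (b : Module.Basis (G ⊕ G) ℤ R) (hl : ∀ g, b (Sum.inl g) = σ g)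
    (hr : ∀ g, b (Sum.inr g) = σ g * p)
    {D : Type*} [CommRing D] [Algebra ℂ D] (ρ : G →* ℂ) (d : D)
    (hd : d * d = algebraMap ℂ D (MonoidAlgebra.lift ℤ ℂ G ρ c) * d) : R →ₐ[ℤ] D :=
  let L : R →ₗ[ℤ] D := b.constr ℤ
    (Sum.elim (fun g => algebraMap ℂ D (ρ g)) (fun g => algebraMap ℂ D (ρ g) * d))
  have hL1 : ∀ g, L (σ g) = algebraMap ℂ D (ρ g) := fun g => by
    rw [← hl, Module.Basis.constr_basis, Sum.elim_inl]
  have hL2 : ∀ g, L (σ g * p) = algebraMap ℂ D (ρ g) * d := fun g => by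
    rw [← hr, Module.Basis.constr_basis, Sum.elim_inr]
  -- Multiplying two basis elements of the second kind produces a general element of $\mathbb ZG$
  -- times `p`, so the value of `L` is needed on all of these.
  have hL3 : ∀ z : MonoidAlgebra ℤ G, L (MonoidAlgebra.lift ℤ R G σ z * p) =
      algebraMap ℂ D (MonoidAlgebra.lift ℤ ℂ G ρ z) * d := fun z => by
    induction z using MonoidAlgebra.induction_on with
    | of g => simp only [MonoidAlgebra.lift_of, hL2]
    | add x y hx hy => simp only [map_add, add_mul, hx, hy]
    | smul n x hx => simp only [map_zsmul, smul_mul_assoc, hx]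
  AlgHom.ofLinearMap L (by rw [← map_one σ, hL1, map_one, map_one]) (by
    -- Both sides are bilinear, so pairs of basis elements suffice. Only the product of two elements
    -- of the second kind uses the quadratic relations `hsq` and `hd`.
    have key : (LinearMap.mul ℤ R).compr₂ L = (LinearMap.mul ℤ D).compl₁₂ L L := by
      refine b.ext fun i => b.ext fun j => ?_
      simp only [LinearMap.compr₂_apply, LinearMap.mul_apply', LinearMap.compl₁₂_apply]
      rcases i with g | g <;> rcases j with h | h <;> simp only [hl, hr]
      · rw [← map_mul, hL1, hL1, hL1, map_mul, map_mul]
      · rw [← mul_assoc, ← map_mul, hL1, hL2, hL2, map_mul, map_mul, mul_assoc]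
      · rw [mul_assoc, hcomm, ← mul_assoc, ← map_mul, hL1, hL2, hL2, map_mul, map_mul]
        ring
      · have h1 : σ g * p * (σ h * p) =
            MonoidAlgebra.lift ℤ R G σ (MonoidAlgebra.of ℤ G (g * h) * c) * p := by
          rw [map_mul, MonoidAlgebra.lift_of, map_mul, mul_assoc _ _ p, ← hsq]
          rw [mul_assoc, ← mul_assoc p, hcomm]
          simp only [mul_assoc]
        rw [h1, hL3, hL2, hL2, map_mul, MonoidAlgebra.lift_of, map_mul, map_mul, map_mul]
        linear_combination (-algebraMap ℂ D (ρ g) * algebraMap ℂ D (ρ h)) * hd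
    exact fun x y => LinearMap.congr_fun₂ key x y)

section

variable (σ : G →* R) (p : R) (c : MonoidAlgebra ℤ G)
    (hcomm : ∀ g, p * σ g = σ g * p) (hsq : p * p = MonoidAlgebra.lift ℤ R G σ c * p)
    (b : Module.Basis (G ⊕ G) ℤ R) (hl : ∀ g, b (Sum.inl g) = σ g)
    (hr : ∀ g, b (Sum.inr g) = σ g * p)
    {D : Type*} [CommRing D] [Algebra ℂ D] (ρ : G →* ℂ) (d : D)
    (hd : d * d = algebraMap ℂ D (MonoidAlgebra.lift ℤ ℂ G ρ c) * d)

lemma twistHom_inl (g : G) :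
    twistHom σ p c hcomm hsq b hl hr ρ d hd (b (Sum.inl g)) = algebraMap ℂ D (ρ g) :=
  (b.constr_basis ℤ _ _).trans rfl

lemma twistHom_inr (g : G) :
    twistHom σ p c hcomm hsq b hl hr ρ d hd (b (Sum.inr g)) = algebraMap ℂ D (ρ g) * d :=
  (b.constr_basis ℤ _ _).trans rfl

/-- The `ℂ`-linear extension of `twistHom`. -/
noncomputable def twistHomC : ℂ ⊗[ℤ] R →ₐ[ℂ] D :=
  Algebra.TensorProduct.productLeftAlgHom (Algebra.ofId ℂ D)
    (twistHom σ p c hcomm hsq b hl hr ρ d hd)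

lemma twistHomC_one_tmul (x : R) : twistHomC σ p c hcomm hsq b hl hr ρ d hd (1 ⊗ₜ x) =
    twistHom σ p c hcomm hsq b hl hr ρ d hd x := by
  simp [twistHomC, Algebra.TensorProduct.productLeftAlgHom]

/-- The coordinates of `x` form two functions on `G`, and the map sees only their Fourier
coefficients at `ρ`. Injectivity of a family of such maps thereby becomes Fourier inversion on `G`.
-/
lemma twistHomC_apply [Fintype G] (x : ℂ ⊗[ℤ] R) :
    twistHomC σ p c hcomm hsq b hl hr ρ d hd x =
      algebraMap ℂ D (∑ g, (Algebra.TensorProduct.basis ℂ b).repr x (Sum.inl g) * ρ g) +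
      algebraMap ℂ D (∑ g, (Algebra.TensorProduct.basis ℂ b).repr x (Sum.inr g) * ρ g) * d := by
  conv_lhs => rw [← (Algebra.TensorProduct.basis ℂ b).sum_repr x]
  simp only [map_sum, Fintype.sum_sum_type, Algebra.TensorProduct.basis_apply, map_add, map_smul,
    twistHomC_one_tmul, twistHom_inl, twistHom_inr, Finset.sum_mul, Algebra.smul_def, map_mul,
    mul_assoc]

end

lemma finite_characters [Finite G] : Finite (G →* ℂˣ) :=
  Nat.finite_of_card_ne_zero (by
    rw [CommGroup.card_monoidHom_of_hasEnoughRootsOfUnity G ℂ]; exact Nat.card_pos.ne')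

/-- The characters of a finite abelian group separate the elements of the group algebra. -/
lemma eq_zero_of_forall_sum_char_eq_zero [Fintype G] (a : G → ℂ)
    (h : ∀ χ : G →* ℂˣ, ∑ g, a g * ((Units.coeHom ℂ).comp χ) g = 0) : a = 0 := by
  classical
  have hcard := CommGroup.card_monoidHom_of_hasEnoughRootsOfUnity G ℂ
  have := finite_characters (G := G)
  let := Fintype.ofFinite (G →* ℂˣ)
  have hinj : Function.Injective fun χ : G →* ℂˣ => (Units.coeHom ℂ).comp χ := fun χ ψ h =>
    MonoidHom.ext fun g => Units.ext (DFunLike.congr_fun h g)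
  -- Distinct characters are linearly independent, and there are as many of them as elements of `G`,
  -- so they span the functions on `G`. The linear form with coefficients `a` vanishes on them and
  -- is therefore zero.
  have hli := (linearIndependent_monoidHom G ℂ).comp _ hinj
  have hspan := hli.span_eq_top_of_card_eq_finrank
    (by rw [Module.finrank_fintype_fun_eq_card, ← Nat.card_eq_fintype_card,
      ← Nat.card_eq_fintype_card, hcard])
  let F : (G → ℂ) →ₗ[ℂ] ℂ := ∑ g, a g • LinearMap.proj g
  have hF : ∀ f, F f = ∑ g, a g * f g := fun f => by simp [F]
  have hF0 : F = 0 := LinearMap.ext_on_range hspan fun χ => by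
    rw [hF]; exact h χ
  funext g
  have := hF (Pi.single g 1)
  rw [hF0] at this
  simpa [Pi.single_apply] using this.symm

instance : Module.Finite ℂ (DualNumber ℂ) := inferInstanceAs (Module.Finite ℂ (ℂ × ℂ))

lemma finrank_dualNumber : Module.finrank ℂ (DualNumber ℂ) = 2 := by
  have : Module.finrank ℂ (ℂ × ℂ) = 2 := by simp
  exact this

lemma eq_zero_of_algebraMap_add_mul_eps_eq_zero {x y : ℂ}
    (h : algebraMap ℂ (DualNumber ℂ) x + algebraMap ℂ (DualNumber ℂ) y * DualNumber.eps = 0) :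
    x = 0 ∧ y = 0 := by
  have hfst := congrArg TrivSqZeroExt.fst h
  have hsnd := congrArg TrivSqZeroExt.snd h
  simp [TrivSqZeroExt.algebraMap_eq_inl'] at hfst hsnd
  exact ⟨hfst, hsnd⟩

lemma card_nonvanishing_le [Finite G] (c : MonoidAlgebra ℤ G) :
    Nat.card {χ : G →* ℂˣ // charValue χ c ≠ 0} ≤ Nat.card G := by
  have := finite_characters (G := G)
  rw [← CommGroup.card_monoidHom_of_hasEnoughRootsOfUnity G ℂ]
  exact Finite.card_subtype_le _

/-- The complexification of a ring that is free on the elements `σ g` and `σ g * p`, where `p`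
is central and `p * p = σ c * p`. -/
theorem nonempty_algEquiv_of_basis [Finite G] (σ : G →* R) (p : R) (c : MonoidAlgebra ℤ G)
    (hcomm : ∀ g, p * σ g = σ g * p) (hsq : p * p = MonoidAlgebra.lift ℤ R G σ c * p)
    (b : Module.Basis (G ⊕ G) ℤ R) (hl : ∀ g, b (Sum.inl g) = σ g)
    (hr : ∀ g, b (Sum.inr g) = σ g * p)
    (s r : ℕ) (hs : s = Nat.card G) (hrc : r = Nat.card {χ : G →* ℂˣ // charValue χ c ≠ 0}) :
    Nonempty ((ℂ ⊗[ℤ] R) ≃ₐ[ℂ] ((Fin (2 * r) → ℂ) × (Fin (s - r) → DualNumber ℂ))) := by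
  classical
  let := Fintype.ofFinite G
  have := finite_characters (G := G)
  have hle : r ≤ s := hs ▸ hrc ▸ card_nonvanishing_le c
  have hX1 : Nat.card ({χ : G →* ℂˣ // charValue χ c ≠ 0} ⊕ {χ : G →* ℂˣ // charValue χ c ≠ 0}) =
      2 * r := by
    rw [Nat.card_sum, ← hrc, two_mul]
  have hX0 : Nat.card {χ : G →* ℂˣ // ¬ charValue χ c ≠ 0} = s - r := by
    have h := Nat.card_congr (Equiv.sumCompl fun χ : G →* ℂˣ => charValue χ c ≠ 0)
    rw [Nat.card_sum, ← hrc, CommGroup.card_monoidHom_of_hasEnoughRootsOfUnity G ℂ, ← hs] at h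
    omega
  let e1 := Finite.equivFinOfCardEq hX1
  let e0 := Finite.equivFinOfCardEq hX0
  -- The admissible values of `d` are the solutions of $d^2=\chi(c)d$. In $\mathbb C$ these are
  -- $\chi(c)$ and $0$, which differ here and give two maps for each such `χ`.
  let f1 : ({χ : G →* ℂˣ // charValue χ c ≠ 0} ⊕ {χ : G →* ℂˣ // charValue χ c ≠ 0}) →
      (ℂ ⊗[ℤ] R →ₐ[ℂ] ℂ) := Sum.elim
    (fun χ => twistHomC σ p c hcomm hsq b hl hr ((Units.coeHom ℂ).comp χ.1) (charValue χ.1 c) rfl)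
    (fun χ => twistHomC σ p c hcomm hsq b hl hr ((Units.coeHom ℂ).comp χ.1) 0 (by simp))
  -- Now $0$ is a double root, and the element `eps` of square zero takes the place of the second
  -- solution.
  let f0 : {χ : G →* ℂˣ // ¬ charValue χ c ≠ 0} → (ℂ ⊗[ℤ] R →ₐ[ℂ] DualNumber ℂ) := fun χ =>
    twistHomC σ p c hcomm hsq b hl hr ((Units.coeHom ℂ).comp χ.1) DualNumber.eps (by
      have h : MonoidAlgebra.lift ℤ ℂ G ((Units.coeHom ℂ).comp χ.1) c = 0 := not_not.mp χ.2
      rw [h, map_zero, zero_mul, DualNumber.eps_mul_eps])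
  let Φ : (ℂ ⊗[ℤ] R) →ₐ[ℂ] ((Fin (2 * r) → ℂ) × (Fin (s - r) → DualNumber ℂ)) :=
    AlgHom.prod (AlgHom.pi fun i => f1 (e1.symm i)) (AlgHom.pi fun i => f0 (e0.symm i))
  have hinj : Function.Injective Φ := by
    rw [injective_iff_map_eq_zero]
    intro x hx
    have h1 : ∀ i, f1 i x = 0 := fun i => by
      have := congrFun (congrArg Prod.fst hx) (e1 i)
      simpa [Φ] using this
    have h0 : ∀ i, f0 i x = 0 := fun i => by
      have := congrFun (congrArg Prod.snd hx) (e0 i)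
      simpa [Φ] using this
    set B := Algebra.TensorProduct.basis ℂ b with hB
    have key : ∀ χ : G →* ℂˣ, ∑ g, B.repr x (Sum.inl g) * ((Units.coeHom ℂ).comp χ) g = 0 ∧
        ∑ g, B.repr x (Sum.inr g) * ((Units.coeHom ℂ).comp χ) g = 0 := by
      intro χ
      -- The map with `d = 0` isolates the first Fourier coefficient. The map with `d = χ(c)` then
      -- gives the second one times $\chi(c)$, which can be cancelled.
      by_cases hχ : charValue χ c ≠ 0
      · have ha := (twistHomC_apply ..).symm.trans (h1 (Sum.inl ⟨χ, hχ⟩))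
        have hb := (twistHomC_apply ..).symm.trans (h1 (Sum.inr ⟨χ, hχ⟩))
        simp only [mul_zero, add_zero, Algebra.algebraMap_self, RingHom.id_apply] at ha hb
        rw [hb, zero_add] at ha
        exact ⟨hb, (mul_eq_zero.mp ha).resolve_right hχ⟩
      · exact eq_zero_of_algebraMap_add_mul_eps_eq_zero
          ((twistHomC_apply ..).symm.trans (h0 ⟨χ, hχ⟩))
    have hl0 := eq_zero_of_forall_sum_char_eq_zero _ fun χ => (key χ).1
    have hr0 := eq_zero_of_forall_sum_char_eq_zero _ fun χ => (key χ).2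
    refine B.repr.map_eq_zero_iff.mp (Finsupp.ext ?_)
    rintro (g | g)
    · exact congrFun hl0 g
    · exact congrFun hr0 g
  have : FiniteDimensional ℂ (ℂ ⊗[ℤ] R) :=
    Module.Basis.finiteDimensional_of_finite (Algebra.TensorProduct.basis ℂ b)
  -- Both dimensions are $2s=2r+2(s-r)$; the truncated subtraction is harmless because `r ≤ s`.
  -- Injectivity then implies bijectivity.
  have hdim : Module.finrank ℂ (ℂ ⊗[ℤ] R) =
      Module.finrank ℂ ((Fin (2 * r) → ℂ) × (Fin (s - r) → DualNumber ℂ)) := by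
    rw [Module.finrank_eq_nat_card_basis (Algebra.TensorProduct.basis ℂ b), Nat.card_sum, ← hs,
      Module.finrank_prod, Module.finrank_fin_fun, Module.finrank_pi_fintype]
    simp only [finrank_dualNumber, Finset.sum_const, Finset.card_univ, Fintype.card_fin,
      smul_eq_mul]
    omega
  have hsurj : Function.Surjective Φ.toLinearMap :=
    (LinearMap.injective_iff_surjective_of_finrank_eq_finrank hdim).mp hinj
  exact ⟨AlgEquiv.ofBijective Φ ⟨hinj, hsurj⟩⟩

end GroupRing

end ProjClass

namespace ProjClass

/-! ### Direct summands, projective covers and semisimplicity -/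

section Splitting

variable {k Λ : Type u} [Field k] [Ring Λ] [Algebra k Λ]

lemma FinMod.finrank_congr {M N : FinMod k Λ} (e : M ≃ₗ[Λ] N) :
    Module.finrank k M = Module.finrank k N :=
  (e.restrictScalars k).finrank_eq

lemma FinMod.finrank_prod (M N : FinMod k Λ) :
    Module.finrank k (M.prod N) = Module.finrank k M + Module.finrank k N :=
  Module.finrank_prod (R := k) (M := M) (M' := N)

/-- A module with a submodule. -/
def FinMod.ofSubmodule (M : FinMod k Λ) (N : Submodule Λ M) : FinMod k Λ :=
  haveI : Module.Finite k N := inferInstanceAs (Module.Finite k (N.restrictScalars k))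
  { carrier := N }

/-- A nonzero module has a simple quotient. -/
lemma exists_surjective_isSimpleModule (M : FinMod k Λ) [Nontrivial M] :
    ∃ S : FinMod k Λ, IsSimpleModule Λ S ∧ ∃ f : M →ₗ[Λ] S, Function.Surjective f := by
  have := M.isNoetherian
  obtain ⟨N, hN⟩ := IsCoatomic.exists_coatom (Submodule Λ M)
  have := Module.Finite.quotient k N
  exact ⟨{ carrier := M ⧸ N }, isSimpleModule_iff_isCoatom.mpr hN, N.mkQ, N.mkQ_surjective⟩

/-- An extension of a projective module splits. -/
lemma nonempty_equiv_prod_of_exact {A B C : FinMod k Λ} (i : A →ₗ[Λ] B) (q : B →ₗ[Λ] C)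
    (hi : Function.Injective i) (hex : Function.Exact i q) (hq : Function.Surjective q)
    (hC : Module.Projective Λ C) : Nonempty (B ≃ₗ[Λ] A.prod C) := by
  obtain ⟨l, hl⟩ := Module.projective_lifting_property q LinearMap.id hq
  exact ⟨(hex.splitSurjectiveEquiv hi ⟨l, hl⟩).1⟩

/-- A split surjection exhibits its target as a direct summand. -/
lemma exists_equiv_prod {M S : FinMod k Λ} (f : M →ₗ[Λ] S) (g : S →ₗ[Λ] M)
    (h : f ∘ₗ g = LinearMap.id) : ∃ N : FinMod k Λ, Nonempty (M ≃ₗ[Λ] N.prod S) := by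
  have hf : Function.Surjective f := fun s => ⟨g s, LinearMap.congr_fun h s⟩
  have hex : Function.Exact (LinearMap.ker f).subtype f := LinearMap.exact_subtype_ker_map f
  exact ⟨M.ofSubmodule (LinearMap.ker f),
    ⟨(hex.splitSurjectiveEquiv (LinearMap.ker f).injective_subtype ⟨g, h⟩).1⟩⟩

lemma projective_fst {M N : FinMod k Λ} (h : Module.Projective Λ (M.prod N)) :
    Module.Projective Λ M :=
  have : Module.Projective Λ (M × N) := h
  Module.Projective.of_split (M := M × N) (LinearMap.inl Λ M N) (LinearMap.fst Λ M N) rfl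

/-- A projective module that maps onto `M` has the projective cover of `M` as a direct
summand. -/
lemma IsProjectiveCover.exists_equiv_prod {P M Q : FinMod k Λ} (hP : IsProjectiveCover P M)
    (hQ : Module.Projective Λ Q) (f : Q →ₗ[Λ] M) (hf : Function.Surjective f) :
    ∃ N : FinMod k Λ, Module.Projective Λ N ∧ Nonempty (Q ≃ₗ[Λ] N.prod P) := by
  obtain ⟨hPp, ψ, hψ, hess⟩ := hP
  obtain ⟨g, hg⟩ := Module.projective_lifting_property ψ f hψ
  -- The range of the lift `g : Q → P` still maps onto `M`, so it is all of `P` because `ψ` is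
  -- essential. As `P` is projective, `g` then splits.
  have hgs : Function.Surjective g := by
    rw [← LinearMap.range_eq_top]
    by_contra hne
    refine hess _ hne fun m => ?_
    obtain ⟨q, rfl⟩ := hf m
    exact ⟨⟨g q, q, rfl⟩, LinearMap.congr_fun hg q⟩
  obtain ⟨l, hl⟩ := Module.projective_lifting_property g LinearMap.id hgs
  obtain ⟨N, ⟨e⟩⟩ := ProjClass.exists_equiv_prod g l hl
  exact ⟨N, projective_fst (Module.Projective.of_equiv e), ⟨e⟩⟩

/-- The kernel of the covering map of a simple module contains all proper submodules. -/
lemma IsProjectiveCover.exists_ker_eq {P S : FinMod k Λ} (hP : IsProjectiveCover P S)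
    (hS : IsSimpleModule Λ S) : ∃ ψ : P →ₗ[Λ] S, Function.Surjective ψ ∧
      ∀ X : Submodule Λ P, X ≠ ⊤ → X ≤ LinearMap.ker ψ := by
  obtain ⟨-, ψ, hψ, hess⟩ := hP
  refine ⟨ψ, hψ, fun X hX => ?_⟩
  -- On such an `X` the map `ψ` is nonzero, hence onto the simple module `S`, which contradicts
  -- essentiality.
  by_contra hle
  refine hess X hX (LinearMap.surjective_of_ne_zero fun h0 => hle fun x hx => ?_)
  exact LinearMap.congr_fun h0 ⟨x, hx⟩

lemma isProjectiveCover_projectiveCover [Module.Finite k Λ] (M : FinMod k Λ) :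
    IsProjectiveCover (projectiveCover M) M :=
  (exists_isProjectiveCover M).choose_spec

lemma projective_projectiveCover [Module.Finite k Λ] (M : FinMod k Λ) :
    Module.Projective Λ (projectiveCover M) :=
  (isProjectiveCover_projectiveCover M).1

lemma isSemisimpleModule_prod (M N : Type*) [AddCommGroup M] [Module Λ M] [AddCommGroup N]
    [Module Λ N] [IsSemisimpleModule Λ M] [IsSemisimpleModule Λ N] :
    IsSemisimpleModule Λ (M × N) := by
  have h := IsSemisimpleModule.sup (IsSemisimpleModule.range (LinearMap.inl Λ M N))
    (IsSemisimpleModule.range (LinearMap.inr Λ M N))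
  rw [LinearMap.sup_range_inl_inr] at h
  exact IsSemisimpleModule.congr Submodule.topEquiv.symm

/-- If the simple modules are projective, all modules are semisimple. -/
lemma isSemisimpleModule_of_forall_simple_projective
    (h : ∀ S : FinMod k Λ, IsSimpleModule Λ S → Module.Projective Λ S) (M : FinMod k Λ) :
    IsSemisimpleModule Λ M := by
  induction hn : Module.finrank k M using Nat.strong_induction_on generalizing M with
  | _ n ih =>
    rcases subsingleton_or_nontrivial M with hM | hM
    · exact (isSemisimpleModule_iff Λ M).mpr Subsingleton.instComplementedLattice
    · obtain ⟨S, hS, f, hf⟩ := exists_surjective_isSimpleModule M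
      have := h S hS
      obtain ⟨l, hl⟩ := Module.projective_lifting_property f LinearMap.id hf
      obtain ⟨N, ⟨e⟩⟩ := exists_equiv_prod f l hl
      have := IsSimpleModule.nontrivial Λ S
      have hpos : 0 < Module.finrank k S := Module.finrank_pos
      have hN := ih _ (by rw [← hn, FinMod.finrank_congr e, FinMod.finrank_prod]; omega) N rfl
      have hNS : IsSemisimpleModule Λ (N.prod S) := isSemisimpleModule_prod (Λ := Λ) N S
      exact IsSemisimpleModule.congr e

end Splitting

variable {k Λ : Type u} [Field k] [Ring Λ] [HopfAlgebra k Λ]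

/-! ### The tensor product as an exact functor -/

namespace FinMod

lemma finrank_tensor (M N : FinMod k Λ) :
    Module.finrank k (M.tensor N) = Module.finrank k M * Module.finrank k N := by
  rw [← (toTensor M N).finrank_eq, Module.finrank_tensorProduct]

lemma finrank_trivial : Module.finrank k (trivial k Λ) = 1 := by
  rw [← (toTrivial k Λ).finrank_eq, Module.finrank_self]

/-- The tensor product of two homomorphisms of modules. -/
noncomputable def tensorMap {M M' N N' : FinMod k Λ} (f : M →ₗ[Λ] M') (g : N →ₗ[Λ] N') :
    M.tensor N →ₗ[Λ] M'.tensor N' :=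
  let F : M.tensor N →ₗ[k] M'.tensor N' := (toTensor M' N').toLinearMap ∘ₗ
    TensorProduct.map (f.restrictScalars k) (g.restrictScalars k) ∘ₗ
      (toTensor M N).symm.toLinearMap
  { F with
    map_smul' := fun a t => by
      change F (a • t) = a • F t
      obtain ⟨t, rfl⟩ := (toTensor M N).surjective t
      induction t with
      | zero => simp only [map_zero, smul_zero]
      | add x y hx hy => simp only [map_add, smul_add, hx, hy]
      | tmul m n =>
        change toTensor M' N' (TensorProduct.map (f.restrictScalars k) (g.restrictScalars k)
          (tensorAction M N a (m ⊗ₜ n))) = toTensor M' N' (tensorAction M' N' a (f m ⊗ₜ g n))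
        simp only [tensorAction_tmul, map_sum, TensorProduct.map_tmul,
          LinearMap.restrictScalars_apply, map_smul] }

lemma tensorMap_toTensor {M M' N N' : FinMod k Λ} (f : M →ₗ[Λ] M') (g : N →ₗ[Λ] N')
    (t : M ⊗[k] N) : tensorMap f g (toTensor M N t) =
      toTensor M' N' (TensorProduct.map (f.restrictScalars k) (g.restrictScalars k) t) := rfl

lemma tensorMap_id (M N : FinMod k Λ) :
    tensorMap (LinearMap.id : M →ₗ[Λ] M) (LinearMap.id : N →ₗ[Λ] N) = LinearMap.id := by
  refine LinearMap.ext fun t => ?_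
  obtain ⟨t, rfl⟩ := (toTensor M N).surjective t
  rw [tensorMap_toTensor]
  exact congrArg (toTensor M N) (LinearMap.congr_fun TensorProduct.map_id t)

lemma tensorMap_comp {M M' M'' N N' N'' : FinMod k Λ} (f : M →ₗ[Λ] M') (f' : M' →ₗ[Λ] M'')
    (g : N →ₗ[Λ] N') (g' : N' →ₗ[Λ] N'') :
    tensorMap f' g' ∘ₗ tensorMap f g = tensorMap (f' ∘ₗ f) (g' ∘ₗ g) := by
  refine LinearMap.ext fun t => ?_
  obtain ⟨t, rfl⟩ := (toTensor M N).surjective t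
  rw [LinearMap.comp_apply, tensorMap_toTensor, tensorMap_toTensor, tensorMap_toTensor]
  exact congrArg (toTensor M'' N'') (TensorProduct.map_map (f'.restrictScalars k)
    (g'.restrictScalars k) (f.restrictScalars k) (g.restrictScalars k) t)

lemma tensorMap_surjective {M M' N N' : FinMod k Λ} {f : M →ₗ[Λ] M'} {g : N →ₗ[Λ] N'}
    (hf : Function.Surjective f) (hg : Function.Surjective g) :
    Function.Surjective (tensorMap f g) := by
  intro t
  obtain ⟨t, rfl⟩ := (toTensor M' N').surjective t
  obtain ⟨t, rfl⟩ := TensorProduct.map_surjective (g := f.restrictScalars k) hf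
    (g' := g.restrictScalars k) hg t
  exact ⟨toTensor M N t, rfl⟩

/-- A short exact sequence tensored with `P` splits, if its last term becomes projective. -/
lemma nonempty_tensor_equiv_prod_of_exact {A B C : FinMod k Λ} (P : FinMod k Λ) (i : A →ₗ[Λ] B)
    (q : B →ₗ[Λ] C) (hi : Function.Injective i) (hex : Function.Exact i q)
    (hq : Function.Surjective q) (hC : Module.Projective Λ (C.tensor P)) :
    Nonempty (B.tensor P ≃ₗ[Λ] (A.tensor P).prod (C.tensor P)) := by
  refine nonempty_equiv_prod_of_exact (tensorMap i (LinearMap.id : P →ₗ[Λ] P))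
    (tensorMap q (LinearMap.id : P →ₗ[Λ] P)) ?_ ?_
    (tensorMap_surjective hq Function.surjective_id) hC
  -- Over the field `k` every module is flat, so tensoring with `P` keeps the sequence exact.
  · intro x y hxy
    exact Module.Flat.rTensor_preserves_injective_linearMap (M := P) (i.restrictScalars k) hi hxy
  · exact rTensor_exact (R := k) P (f := i.restrictScalars k) (g := q.restrictScalars k) hex hq

end FinMod

lemma nonempty_equiv_of_cls_eq {M N : FinMod k Λ} (h : cls M = cls N) : Nonempty (M ≃ₗ[Λ] N) :=
  Quotient.exact h

lemma exists_surjective_of_cls_eq {M N N' : FinMod k Λ} (f : M →ₗ[Λ] N)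
    (hf : Function.Surjective f) (h : cls N = cls N') :
    ∃ f : M →ₗ[Λ] N', Function.Surjective f := by
  obtain ⟨e⟩ := nonempty_equiv_of_cls_eq h
  exact ⟨e.toLinearMap ∘ₗ f, e.surjective.comp hf⟩

/-! ### Criteria for projectivity and for being a projective cover -/

section Finite

variable [Module.Finite k Λ]

/-- A module is projective as soon as the functors `F` and `G`, with `G` preserving projective
modules, make it so, and `G ∘ F` is isomorphic to the identity. -/
lemma projective_of_functor {M : FinMod k Λ} (F : FinMod k Λ → FinMod k Λ)
    (Fmap : ∀ {X Y : FinMod k Λ}, (X →ₗ[Λ] Y) → (F X →ₗ[Λ] F Y))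
    (hFs : ∀ {X Y : FinMod k Λ} (f : X →ₗ[Λ] Y), Function.Surjective f →
      Function.Surjective (Fmap f))
    (G : FinMod k Λ → FinMod k Λ)
    (Gmap : ∀ {X Y : FinMod k Λ}, (X →ₗ[Λ] Y) → (G X →ₗ[Λ] G Y))
    (hG : ∀ {X Y : FinMod k Λ} (f : X →ₗ[Λ] Y) (g : Y →ₗ[Λ] X), f ∘ₗ g = LinearMap.id →
      Gmap f ∘ₗ Gmap g = LinearMap.id)
    (hGF : ∀ X, Nonempty (G (F X) ≃ₗ[Λ] X)) (h : Module.Projective Λ (F M)) :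
    Module.Projective Λ M := by
  have : Module.Finite Λ M := Module.Finite.of_restrictScalars_finite k Λ M
  obtain ⟨n, f, hf⟩ := Module.Finite.exists_fin' Λ M
  let X : FinMod k Λ := { carrier := Fin n → Λ }
  have hX : Module.Projective Λ X := inferInstanceAs (Module.Projective Λ (Fin n → Λ))
  -- A free module `X` maps onto `M`, and `F X → F M` splits because `F M` is projective. Applying
  -- `G` makes `M ≅ G (F M)` a retract of `G (F X) ≅ X`; all that is used of `G` on maps is that it
  -- preserves retractions.
  obtain ⟨l, hl⟩ := Module.projective_lifting_property (Fmap (X := X) f) LinearMap.id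
    (hFs (X := X) f hf)
  obtain ⟨eX⟩ := hGF X
  obtain ⟨eM⟩ := hGF M
  have : Module.Projective Λ (G (F X)) := Module.Projective.of_equiv eX.symm
  have : Module.Projective Λ (G (F M)) := Module.Projective.of_split _ _ (hG _ _ hl)
  exact Module.Projective.of_equiv eM

/-- Let `Q` and `R` be projective modules that map onto `M` and `N`. If `Q` has the dimension of
the projective cover of `N` and `R` that of the projective cover of `M`, then `Q` is the projective
cover of `M`. -/
lemma cls_eq_projectiveCover {M N Q R : FinMod k Λ} (hQ : Module.Projective Λ Q)
    (hR : Module.Projective Λ R) (f : Q →ₗ[Λ] M) (hf : Function.Surjective f) (g : R →ₗ[Λ] N)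
    (hg : Function.Surjective g)
    (hQN : Module.finrank k Q = Module.finrank k (projectiveCover N))
    (hRM : Module.finrank k R = Module.finrank k (projectiveCover M)) :
    cls Q = cls (projectiveCover M) := by
  -- Splitting off the covers gives $\dim P(N)=\dim A+\dim P(M)$ and $\dim P(M)=\dim B+\dim P(N)$,
  -- so $A=0$. No essentiality of `f` or `g` has to be checked.
  obtain ⟨A, -, ⟨eA⟩⟩ := (isProjectiveCover_projectiveCover M).exists_equiv_prod hQ f hf
  obtain ⟨B, -, ⟨eB⟩⟩ := (isProjectiveCover_projectiveCover N).exists_equiv_prod hR g hg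
  have hA := FinMod.finrank_congr eA
  have hB := FinMod.finrank_congr eB
  rw [FinMod.finrank_prod] at hA hB
  have h0 : Module.finrank k A = 0 := by omega
  have hsub : Subsingleton A := Module.finrank_zero_iff.mp h0
  have hbij : Function.Bijective (LinearMap.snd Λ A (projectiveCover M)) :=
    ⟨fun x y h => Prod.ext (Subsingleton.elim _ _) h, LinearMap.snd_surjective⟩
  exact cls_eq k Λ ⟨eA.trans (LinearEquiv.ofBijective _ hbij)⟩

lemma exists_projectiveCover_surjective (M : FinMod k Λ) :
    ∃ f : projectiveCover M →ₗ[Λ] M, Function.Surjective f := by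
  obtain ⟨-, ψ, hψ, -⟩ := isProjectiveCover_projectiveCover M
  exact ⟨ψ, hψ⟩

end Finite

/-! ### Simple modules are invertible: tensoring with them -/

section Simple

variable [Module.Finite k Λ] [IsSplit k Λ] [IsBasic k Λ]

/-- Simple modules are invertible. -/
lemma exists_inverse {S : FinMod k Λ} (hS : IsSimpleModule Λ S) :
    ∃ T : FinMod k Λ, IsSimpleModule Λ T ∧ cls T * cls S = 1 ∧ cls S * cls T = 1 := by
  let g : StructureGroup k Λ := ⟨cls S, S, hS, rfl⟩
  obtain ⟨T, hT, hTg⟩ := g⁻¹.2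
  refine ⟨T, hT, ?_, ?_⟩
  · rw [hTg]
    exact congrArg Subtype.val (inv_mul_cancel g)
  · rw [hTg]
    exact congrArg Subtype.val (mul_inv_cancel g)

/-- Tensoring with a simple module on the left preserves projective modules. -/
lemma projective_simple_tensor {S P : FinMod k Λ} (hS : IsSimpleModule Λ S)
    (hP : Module.Projective Λ P) : Module.Projective Λ (S.tensor P) := by
  obtain ⟨T, hT, hTS, hST⟩ := exists_inverse hS
  -- The criterion is applied to the module `S ⊗ P`: tensoring with the inverse `T` turns it into a
  -- copy of `P`.
  refine projective_of_functor (fun X => T.tensor X) (fun f => FinMod.tensorMap LinearMap.id f)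
    (fun f hf => FinMod.tensorMap_surjective Function.surjective_id hf)
    (fun X => S.tensor X) (fun f => FinMod.tensorMap LinearMap.id f)
    (fun f g h => ?_) (fun X => nonempty_equiv_of_cls_eq ?_) ?_
  · rw [FinMod.tensorMap_comp, h, LinearMap.id_comp, FinMod.tensorMap_id]
  · rw [← cls_mul, ← cls_mul, ← mul_assoc, hST, one_mul]
  · obtain ⟨e⟩ : Nonempty (P ≃ₗ[Λ] T.tensor (S.tensor P)) := nonempty_equiv_of_cls_eq (by
      rw [← cls_mul, ← cls_mul, ← mul_assoc, hTS, one_mul])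
    exact Module.Projective.of_equiv e

/-- Tensoring with a simple module on the right preserves projective modules. -/
lemma projective_tensor_simple {S P : FinMod k Λ} (hS : IsSimpleModule Λ S)
    (hP : Module.Projective Λ P) : Module.Projective Λ (P.tensor S) := by
  obtain ⟨T, hT, hTS, hST⟩ := exists_inverse hS
  refine projective_of_functor (fun X => X.tensor T) (fun f => FinMod.tensorMap f LinearMap.id)
    (fun f hf => FinMod.tensorMap_surjective hf Function.surjective_id)
    (fun X => X.tensor S) (fun f => FinMod.tensorMap f LinearMap.id)
    (fun f g h => ?_) (fun X => nonempty_equiv_of_cls_eq ?_) ?_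
  · rw [FinMod.tensorMap_comp, h, LinearMap.id_comp, FinMod.tensorMap_id]
  · rw [← cls_mul, ← cls_mul, mul_assoc, hTS, mul_one]
  · obtain ⟨e⟩ : Nonempty (P ≃ₗ[Λ] (P.tensor S).tensor T) := nonempty_equiv_of_cls_eq (by
      rw [← cls_mul, ← cls_mul, mul_assoc, hST, mul_one])
    exact Module.Projective.of_equiv e

/-- The projective cover of a simple module `S` is `S ⊗ P₁`. -/
lemma cls_simple_mul_projectiveCover_trivial {S : FinMod k Λ} (hS : IsSimpleModule Λ S) :
    cls S * cls (projectiveCover (FinMod.trivial k Λ)) = cls (projectiveCover S) := by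
  obtain ⟨T, hT, hTS, hST⟩ := exists_inverse hS
  obtain ⟨φ, hφ⟩ := exists_projectiveCover_surjective (FinMod.trivial k Λ)
  obtain ⟨ψ, hψ⟩ := exists_projectiveCover_surjective S
  -- The two projective modules to compare are `S ⊗ P₁`, which maps onto `S`, and `T ⊗ P_S`, which
  -- maps onto `T ⊗ S ≅ k`. Since `S` and `T` are one-dimensional, they have the dimensions of `P₁`
  -- and `P_S`.
  obtain ⟨f, hf⟩ := exists_surjective_of_cls_eq (FinMod.tensorMap (LinearMap.id : S →ₗ[Λ] S) φ)
    (FinMod.tensorMap_surjective Function.surjective_id hφ) (mul_one (cls S))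
  obtain ⟨g, hg⟩ := exists_surjective_of_cls_eq (FinMod.tensorMap (LinearMap.id : T →ₗ[Λ] T) ψ)
    (FinMod.tensorMap_surjective Function.surjective_id hψ) (N' := FinMod.trivial k Λ) hTS
  rw [cls_mul]
  refine cls_eq_projectiveCover (projective_simple_tensor hS (projective_projectiveCover _))
    (projective_simple_tensor hT (projective_projectiveCover _)) f hf g hg ?_ ?_
  · rw [FinMod.finrank_tensor, finrank_eq_one S hS, one_mul]
  · rw [FinMod.finrank_tensor, finrank_eq_one T hT, one_mul]

/-- The projective cover of a simple module `S` is `P₁ ⊗ S`. -/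
lemma cls_projectiveCover_trivial_mul_simple {S : FinMod k Λ} (hS : IsSimpleModule Λ S) :
    cls (projectiveCover (FinMod.trivial k Λ)) * cls S = cls (projectiveCover S) := by
  obtain ⟨T, hT, hTS, hST⟩ := exists_inverse hS
  obtain ⟨φ, hφ⟩ := exists_projectiveCover_surjective (FinMod.trivial k Λ)
  obtain ⟨ψ, hψ⟩ := exists_projectiveCover_surjective S
  obtain ⟨f, hf⟩ := exists_surjective_of_cls_eq (FinMod.tensorMap φ (LinearMap.id : S →ₗ[Λ] S))
    (FinMod.tensorMap_surjective hφ Function.surjective_id) (one_mul (cls S))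
  obtain ⟨g, hg⟩ := exists_surjective_of_cls_eq (FinMod.tensorMap ψ (LinearMap.id : T →ₗ[Λ] T))
    (FinMod.tensorMap_surjective hψ Function.surjective_id) (N' := FinMod.trivial k Λ) hST
  rw [cls_mul]
  refine cls_eq_projectiveCover (projective_tensor_simple hS (projective_projectiveCover _))
    (projective_tensor_simple hT (projective_projectiveCover _)) f hf g hg ?_ ?_
  · rw [FinMod.finrank_tensor, finrank_eq_one S hS, mul_one]
  · rw [FinMod.finrank_tensor, finrank_eq_one T hT, mul_one]

/-- If `Λ` is not semisimple, no simple module is projective. -/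
lemma not_projective_of_isSimpleModule (hns : ¬ IsSemisimpleRing Λ) {S : FinMod k Λ}
    (hS : IsSimpleModule Λ S) : ¬ Module.Projective Λ S := by
  intro hp
  refine hns ?_
  obtain ⟨T, hT, hTS, -⟩ := exists_inverse hS
  -- One projective simple module `S` makes all of them projective, since `S' ≅ S' ⊗ (T ⊗ S)`. Then
  -- `Λ` itself is semisimple.
  have h := isSemisimpleModule_of_forall_simple_projective (k := k) (Λ := Λ) (fun S' hS' => by
    have h1 := projective_simple_tensor hS' (projective_simple_tensor hT hp)
    obtain ⟨e⟩ : Nonempty (S'.tensor (T.tensor S) ≃ₗ[Λ] S') := nonempty_equiv_of_cls_eq (by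
      rw [← cls_mul, ← cls_mul, hTS, mul_one])
    exact Module.Projective.of_equiv e) { carrier := Λ }
  exact h

end Simple

end ProjClass

namespace ProjClass

/-! ### Two additive invariants that tell simple modules from projective covers -/

section Multiplicities

variable {k Λ : Type u} [Field k] [Ring Λ] [Algebra k Λ]

/-- The `Λ`-linear maps, as a subspace of the space of `k`-linear maps. -/
def homSubmodule (M T : FinMod k Λ) : Submodule k (M →ₗ[k] T) where
  carrier := {f | ∀ (a : Λ) (m : M), f (a • m) = a • f m}
  zero_mem' := fun a m => by simp
  add_mem' := fun {f g} hf hg a m => by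
    rw [LinearMap.add_apply, LinearMap.add_apply, hf, hg, smul_add]
  smul_mem' := fun c f hf a m => by
    rw [LinearMap.smul_apply, LinearMap.smul_apply, hf, smul_comm]

/-- The `Λ`-linear maps `f` from `M` to `T` such that `f ∘ h = 0` for all maps `h : T → M`. -/
def radSubmodule (M T : FinMod k Λ) : Submodule k (M →ₗ[k] T) where
  carrier := {f | f ∈ homSubmodule M T ∧ ∀ (h : T →ₗ[Λ] M) (t : T), f (h t) = 0}
  zero_mem' := ⟨zero_mem _, fun h t => rfl⟩
  add_mem' := fun {f g} hf hg => ⟨add_mem hf.1 hg.1, fun h t => by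
    rw [LinearMap.add_apply, hf.2, hg.2, add_zero]⟩
  smul_mem' := fun c f hf => ⟨Submodule.smul_mem _ c hf.1, fun h t => by
    rw [LinearMap.smul_apply, hf.2, smul_zero]⟩

/-- Stated for abstract subspaces so that it yields additivity on direct sums for both
`homSubmodule` and `radSubmodule`. -/
lemma finrank_eq_of_forall_coprod_mem_iff {M N T : Type*} [AddCommGroup M] [Module k M]
    [Module.Finite k M] [AddCommGroup N] [Module k N] [Module.Finite k N] [AddCommGroup T]
    [Module k T] [Module.Finite k T] {U : Submodule k (M × N →ₗ[k] T)}
    {V : Submodule k (M →ₗ[k] T)} {W : Submodule k (N →ₗ[k] T)}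
    (h : ∀ f g, LinearMap.coprod f g ∈ U ↔ f ∈ V ∧ g ∈ W) :
    Module.finrank k U = Module.finrank k V + Module.finrank k W := by
  let e : (V × W) ≃ₗ[k] U :=
    { toFun := fun x => ⟨LinearMap.coprod x.1.1 x.2.1, (h _ _).mpr ⟨x.1.2, x.2.2⟩⟩
      invFun := fun f =>
        have hf := (h (f.1 ∘ₗ LinearMap.inl k M N) (f.1 ∘ₗ LinearMap.inr k M N)).mp
          (by rw [← LinearMap.comp_coprod, LinearMap.coprod_inl_inr, LinearMap.comp_id]; exact f.2)
        (⟨_, hf.1⟩, ⟨_, hf.2⟩)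
      map_add' := fun x y => Subtype.ext (LinearMap.ext fun m => by simp; abel)
      map_smul' := fun c x => Subtype.ext (LinearMap.ext fun m => by simp)
      left_inv := fun x => by ext <;> simp
      right_inv := fun f => Subtype.ext (LinearMap.ext fun m => by simp) }
  rw [← e.finrank_eq, Module.finrank_prod]

lemma finrank_eq_of_forall_comp_mem_iff {M N T : Type*} [AddCommGroup M] [Module k M]
    [AddCommGroup N] [Module k N] [AddCommGroup T] [Module k T] (e : M ≃ₗ[k] N)
    {U : Submodule k (M →ₗ[k] T)} {V : Submodule k (N →ₗ[k] T)}
    (h : ∀ f, f ∘ₗ e.toLinearMap ∈ U ↔ f ∈ V) :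
    Module.finrank k U = Module.finrank k V := by
  let E : (M →ₗ[k] T) ≃ₗ[k] (N →ₗ[k] T) := e.arrowCongr (LinearEquiv.refl k T)
  have hUV : U.map E.toLinearMap = V := by
    ext f
    constructor
    · rintro ⟨g, hg, rfl⟩
      refine (h _).mp ?_
      have : E.toLinearMap g ∘ₗ e.toLinearMap = g := by ext m; simp [E]
      rwa [this]
    · intro hf
      refine ⟨_, (h f).mpr hf, ?_⟩
      ext m
      simp [E]
  rw [← hUV]
  exact (LinearEquiv.finrank_map_eq E U).symm

lemma coprod_mem_homSubmodule_iff {M N T : FinMod k Λ} (f : M →ₗ[k] T) (g : N →ₗ[k] T) :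
    LinearMap.coprod f g ∈ homSubmodule (M.prod N) T ↔
      f ∈ homSubmodule M T ∧ g ∈ homSubmodule N T := by
  constructor
  · intro h
    refine ⟨fun a m => ?_, fun a n => ?_⟩
    · have h1 : f (a • m) + g (a • 0) = a • (f m + g 0) := h a (m, 0)
      simpa using h1
    · have h1 : f (a • 0) + g (a • n) = a • (f 0 + g n) := h a (0, n)
      simpa using h1
  · rintro ⟨hf, hg⟩ a ⟨m, n⟩
    change f (a • m) + g (a • n) = a • (f m + g n)
    rw [hf, hg, smul_add]

/-- The components of a map `T → M × N` are test maps into `M` and `N`; conversely a test map into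
one summand becomes one into the product by inclusion. -/
lemma coprod_mem_radSubmodule_iff {M N T : FinMod k Λ} (f : M →ₗ[k] T) (g : N →ₗ[k] T) :
    LinearMap.coprod f g ∈ radSubmodule (M.prod N) T ↔
      f ∈ radSubmodule M T ∧ g ∈ radSubmodule N T := by
  refine ⟨fun h => ?_, fun h => ⟨(coprod_mem_homSubmodule_iff f g).mpr ⟨h.1.1, h.2.1⟩, ?_⟩⟩
  · obtain ⟨hf, hg⟩ := (coprod_mem_homSubmodule_iff f g).mp h.1
    refine ⟨⟨hf, fun i t => ?_⟩, ⟨hg, fun i t => ?_⟩⟩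
    · have h1 : f (i t) + g 0 = 0 := h.2 (LinearMap.inl Λ M N ∘ₗ i) t
      simpa using h1
    · have h1 : f 0 + g (i t) = 0 := h.2 (LinearMap.inr Λ M N ∘ₗ i) t
      simpa using h1
  · intro i t
    have h1 := h.1.2 (LinearMap.fst Λ M N ∘ₗ i) t
    have h2 := h.2.2 (LinearMap.snd Λ M N ∘ₗ i) t
    change f (i t).1 + g (i t).2 = 0
    exact (congrArg₂ (· + ·) h1 h2).trans (add_zero 0)

lemma comp_mem_homSubmodule_iff {M N T : FinMod k Λ} (e : M ≃ₗ[Λ] N) (f : N →ₗ[k] T) :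
    f ∘ₗ (e.restrictScalars k).toLinearMap ∈ homSubmodule M T ↔ f ∈ homSubmodule N T := by
  constructor
  · intro h a n
    obtain ⟨m, rfl⟩ := e.surjective n
    have h1 : f (e (a • m)) = a • f (e m) := h a m
    rwa [map_smul] at h1
  · intro h a m
    change f (e (a • m)) = a • f (e m)
    rw [map_smul, h]

lemma comp_mem_radSubmodule_iff {M N T : FinMod k Λ} (e : M ≃ₗ[Λ] N) (f : N →ₗ[k] T) :
    f ∘ₗ (e.restrictScalars k).toLinearMap ∈ radSubmodule M T ↔ f ∈ radSubmodule N T := by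
  constructor
  · refine fun h => ⟨(comp_mem_homSubmodule_iff e f).mp h.1, fun i t => ?_⟩
    have h1 : f (e (e.symm (i t))) = 0 := h.2 (e.symm.toLinearMap ∘ₗ i) t
    rwa [e.apply_symm_apply] at h1
  · exact fun h => ⟨(comp_mem_homSubmodule_iff e f).mpr h.1, fun i t =>
      h.2 (e.toLinearMap ∘ₗ i) t⟩

/-- A `k`-linear map that is `Λ`-linear. -/
def toHom {M T : FinMod k Λ} (f : M →ₗ[k] T) (hf : f ∈ homSubmodule M T) : M →ₗ[Λ] T :=
  { f with map_smul' := hf }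

lemma radSubmodule_le {M T : FinMod k Λ} : radSubmodule M T ≤ homSubmodule M T := fun _ h => h.1

section Simple

variable {S T : FinMod k Λ}

/-- A nonzero map of simple modules is invertible, and its inverse is a test map that it does not
kill. -/
lemma radSubmodule_simple (hS : IsSimpleModule Λ S) (hT : IsSimpleModule Λ T) :
    radSubmodule S T = ⊥ := by
  rw [eq_bot_iff]
  rintro f ⟨hf, h⟩
  by_contra hne
  have hbij := LinearMap.bijective_of_ne_zero (f := toHom f hf) fun h0 =>
    hne (LinearMap.ext fun m => LinearMap.congr_fun h0 m)
  let e := LinearEquiv.ofBijective (toHom f hf) hbij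
  refine hne (LinearMap.ext fun m => ?_)
  have h1 := h e.symm.toLinearMap (e m)
  rwa [LinearEquiv.coe_coe, e.symm_apply_apply] at h1

/-- The kernel of a nonzero map `P → T` is a maximal submodule. The only one is the kernel of `P →
S`, so both quotients coincide. -/
lemma homSubmodule_eq_bot_of_isProjectiveCover {P : FinMod k Λ} (hP : IsProjectiveCover P S)
    (hS : IsSimpleModule Λ S) (hT : IsSimpleModule Λ T) (hST : ¬ Nonempty (S ≃ₗ[Λ] T)) :
    homSubmodule P T = ⊥ := by
  obtain ⟨ψ, hψ, hker⟩ := hP.exists_ker_eq hS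
  rw [eq_bot_iff]
  intro f hf
  by_contra hne
  have hne' : toHom f hf ≠ 0 := fun h0 => hne (LinearMap.ext fun m => LinearMap.congr_fun h0 m)
  have hs := LinearMap.surjective_of_ne_zero hne'
  have hmax : IsCoatom (LinearMap.ker (toHom f hf)) :=
    LinearMap.isCoatom_ker_of_surjective hs
  have hmaxψ : IsCoatom (LinearMap.ker ψ) := LinearMap.isCoatom_ker_of_surjective hψ
  have heq : LinearMap.ker (toHom f hf) = LinearMap.ker ψ :=
    (hmax.le_iff.mp (hker _ hmax.1)).resolve_left hmaxψ.1 |>.symm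
  exact hST ⟨(ψ.quotKerEquivOfSurjective hψ).symm.trans
    ((Submodule.quotEquivOfEq _ _ heq.symm).trans ((toHom f hf).quotKerEquivOfSurjective hs))⟩

/-- Every map `P → S` kills the unique maximal submodule and so factors through `ψ`; the
endomorphism of `S` that results is a scalar because `Λ` is split. -/
lemma finrank_homSubmodule_of_isProjectiveCover [IsSplit k Λ] {P : FinMod k Λ} (hP : IsProjectiveCover P S)
    (hS : IsSimpleModule Λ S) : Module.finrank k (homSubmodule P S) = 1 := by
  obtain ⟨ψ, hψ, hker⟩ := hP.exists_ker_eq hS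
  have := IsSimpleModule.nontrivial Λ S
  let ψ' : homSubmodule P S := ⟨ψ.restrictScalars k, fun a m => map_smul ψ a m⟩
  have hψ0 : ψ' ≠ 0 := by
    intro h0
    obtain ⟨s, hs⟩ := exists_ne (0 : S)
    obtain ⟨p, rfl⟩ := hψ s
    exact hs (LinearMap.congr_fun (congrArg Subtype.val h0) p)
  refine _root_.finrank_eq_one ψ' hψ0 fun f => ?_
  have hle : LinearMap.ker ψ ≤ LinearMap.ker (toHom f.1 f.2) := by
    by_cases h0 : toHom f.1 f.2 = 0
    · rw [h0, LinearMap.ker_zero]; exact le_top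
    · have hmax := LinearMap.isCoatom_ker_of_surjective (LinearMap.surjective_of_ne_zero h0)
      have hmaxψ : IsCoatom (LinearMap.ker ψ) := LinearMap.isCoatom_ker_of_surjective hψ
      exact ((hmax.le_iff.mp (hker _ hmax.1)).resolve_left hmaxψ.1).le
  let φ : S →ₗ[Λ] S := (LinearMap.ker ψ).liftQ (toHom f.1 f.2) hle ∘ₗ
    (ψ.quotKerEquivOfSurjective hψ).symm.toLinearMap
  have hφ : ∀ p, φ (ψ p) = f.1 p := fun p => by
    have : (ψ.quotKerEquivOfSurjective hψ).symm (ψ p) = (LinearMap.ker ψ).mkQ p := by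
      rw [LinearEquiv.symm_apply_eq]; rfl
    simp only [φ, LinearMap.comp_apply, LinearEquiv.coe_coe, this]
    rfl
  obtain ⟨c, hc⟩ := (IsSplit.bijective (k := k) S hS).2 φ
  refine ⟨c, Subtype.ext (LinearMap.ext fun p => ?_)⟩
  rw [← hφ p, ← hc]
  rfl

lemma homSubmodule_eq_bot_of_not_equiv (hS : IsSimpleModule Λ S) (hT : IsSimpleModule Λ T)
    (hST : ¬ Nonempty (S ≃ₗ[Λ] T)) : homSubmodule S T = ⊥ := by
  rw [eq_bot_iff]
  intro f hf
  by_contra hne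
  have hbij := LinearMap.bijective_of_ne_zero (f := toHom f hf) fun h0 =>
    hne (LinearMap.ext fun m => LinearMap.congr_fun h0 m)
  exact hST ⟨LinearEquiv.ofBijective _ hbij⟩

lemma finrank_homSubmodule_self [IsSplit k Λ] (hS : IsSimpleModule Λ S) :
    Module.finrank k (homSubmodule S S) = 1 := by
  have := IsSimpleModule.nontrivial Λ S
  let i : homSubmodule S S := ⟨LinearMap.id, fun a m => rfl⟩
  refine _root_.finrank_eq_one i (fun h0 => ?_) fun f => ?_
  · obtain ⟨s, hs⟩ := exists_ne (0 : S)
    exact hs (LinearMap.congr_fun (congrArg Subtype.val h0) s)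
  · obtain ⟨c, hc⟩ := (IsSplit.bijective (k := k) S hS).2 (toHom f.1 f.2)
    refine ⟨c, Subtype.ext (LinearMap.ext fun p => ?_)⟩
    exact LinearMap.congr_fun hc p

/-- A simple module that is not projective is not a direct summand of a projective module. -/
lemma radSubmodule_of_isProjectiveCover {P : FinMod k Λ} (hP : IsProjectiveCover P S)
    (hT : IsSimpleModule Λ T) (hTp : ¬ Module.Projective Λ T) :
    radSubmodule P T = homSubmodule P T := by
  refine le_antisymm radSubmodule_le fun f hf => ⟨hf, fun h => ?_⟩
  by_contra hne
  have hcomp : toHom f hf ∘ₗ h ≠ 0 := fun h0 => hne fun t => LinearMap.congr_fun h0 t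
  -- By Schur's lemma the nonzero composite `T → P → T` is invertible, so `T` is a direct summand of
  -- `P` and thus projective.
  let e := LinearEquiv.ofBijective _ (LinearMap.bijective_of_ne_zero hcomp)
  have := hP.1
  refine hTp (Module.Projective.of_split h (e.symm.toLinearMap ∘ₗ toHom f hf) ?_)
  exact LinearMap.ext fun t => e.symm_apply_apply t

end Simple

end Multiplicities

end ProjClass

namespace ProjClass

variable {k Λ : Type u} [Field k] [Ring Λ] [HopfAlgebra k Λ]

/-! ### Calculus in the Grothendieck ring -/

namespace K0

variable (k Λ) in
/-- The class in `K₀(Λ)` of an isomorphism class of modules. -/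
def ofClass : IsoClass k Λ →* K0 k Λ :=
  ((splitIdeal k Λ).ringCon.mk' : FreeAbelianGroup (IsoClass k Λ) →* K0 k Λ).comp
    FreeAbelianGroup.ofMulHom

lemma ofClass_cls (M : FinMod k Λ) : ofClass k Λ (cls M) = K0.mk M := rfl

lemma mk_congr {M N : FinMod k Λ} (e : M ≃ₗ[Λ] N) : K0.mk M = K0.mk N := by
  rw [← ofClass_cls, ← ofClass_cls, cls_eq k Λ ⟨e⟩]

lemma mk_tensor (M N : FinMod k Λ) : K0.mk (M.tensor N) = K0.mk M * K0.mk N := by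
  rw [← ofClass_cls, ← cls_mul, map_mul, ofClass_cls, ofClass_cls]

lemma mk_prod (M N : FinMod k Λ) : K0.mk (M.prod N) = K0.mk M + K0.mk N := by
  have h : (splitIdeal k Λ).ringCon (FreeAbelianGroup.of (cls (M.prod N)))
      (FreeAbelianGroup.of (cls M) + FreeAbelianGroup.of (cls N)) := by
    rw [TwoSidedIdeal.rel_iff, ← sub_sub]
    exact AddSubgroup.subset_closure ⟨M, N, rfl⟩
  exact ((RingCon.eq _).mpr h).trans (map_add ((splitIdeal k Λ).ringCon.mk') _ _)

lemma mk_eq_zero (M : FinMod k Λ) [Subsingleton M] : K0.mk M = 0 := by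
  have h := mk_prod M M
  rw [mk_congr (M := M.prod M) (N := M) (LinearEquiv.ofBijective (LinearMap.fst Λ M M)
    ⟨fun x y _ => Prod.ext (Subsingleton.elim _ _) (Subsingleton.elim _ _),
      LinearMap.fst_surjective⟩)] at h
  exact left_eq_add.mp h

/-- A function on modules that is additive on direct sums extends to `K₀(Λ)`. -/
noncomputable def lift {A : Type*} [AddCommGroup A] (f : FinMod k Λ → A)
    (hiso : ∀ M N : FinMod k Λ, (M ≃ₗ[Λ] N) → f M = f N)
    (hadd : ∀ M N : FinMod k Λ, f (M.prod N) = f M + f N) : K0 k Λ →+ A :=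
  let F : FreeAbelianGroup (IsoClass k Λ) →+ A :=
    FreeAbelianGroup.lift fun x => Quotient.liftOn x f fun _ _ ⟨e⟩ => hiso _ _ e
  AddCon.lift (splitIdeal k Λ).ringCon.toAddCon F (fun x y h => by
    have hxy : x - y ∈ splitRelations k Λ := by
      have h1 := (TwoSidedIdeal.rel_iff _ _ _).mp h
      rwa [splitIdeal, TwoSidedIdeal.mem_mk'] at h1
    have hle : splitRelations k Λ ≤ F.ker := by
      refine (AddSubgroup.closure_le _).mpr ?_
      rintro _ ⟨X, Y, rfl⟩
      change F _ = 0
      simp only [F, map_sub, FreeAbelianGroup.lift_apply_of]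
      change f (X.prod Y) - f X - f Y = 0
      rw [hadd]
      abel
    have h0 : F (x - y) = 0 := hle hxy
    rw [map_sub, sub_eq_zero] at h0
    exact h0)

lemma lift_mk {A : Type*} [AddCommGroup A] (f : FinMod k Λ → A)
    (hiso : ∀ M N : FinMod k Λ, (M ≃ₗ[Λ] N) → f M = f N)
    (hadd : ∀ M N : FinMod k Λ, f (M.prod N) = f M + f N) (M : FinMod k Λ) :
    lift f hiso hadd (K0.mk M) = f M :=
  FreeAbelianGroup.lift_apply_of _ _

variable (T : FinMod k Λ)

/-- The dimension of the space of homomorphisms to `T`. -/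
noncomputable def homMult : K0 k Λ →+ ℤ :=
  lift (fun M => (Module.finrank k (homSubmodule M T) : ℤ))
    (fun _ _ e => congrArg Nat.cast
      (finrank_eq_of_forall_comp_mem_iff (e.restrictScalars k) (comp_mem_homSubmodule_iff e)))
    (fun M N => by
      rw [← Nat.cast_add]
      exact congrArg Nat.cast (finrank_eq_of_forall_coprod_mem_iff coprod_mem_homSubmodule_iff))

/-- The dimension of the space of homomorphisms to `T` that are not split. -/
noncomputable def radMult : K0 k Λ →+ ℤ :=
  lift (fun M => (Module.finrank k (radSubmodule M T) : ℤ))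
    (fun _ _ e => congrArg Nat.cast
      (finrank_eq_of_forall_comp_mem_iff (e.restrictScalars k) (comp_mem_radSubmodule_iff e)))
    (fun M N => by
      rw [← Nat.cast_add]
      exact congrArg Nat.cast (finrank_eq_of_forall_coprod_mem_iff coprod_mem_radSubmodule_iff))

lemma homMult_mk (M : FinMod k Λ) :
    homMult T (K0.mk M) = Module.finrank k (homSubmodule M T) := lift_mk _ _ _ M

lemma radMult_mk (M : FinMod k Λ) :
    radMult T (K0.mk M) = Module.finrank k (radSubmodule M T) := lift_mk _ _ _ M

/-- In general $[B]\ne[A]+[B/A]$, as only split sequences give relations. After multiplication by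
$[P]$ the relation holds, because the tensored sequence ends in a projective module. -/
lemma mk_ofSubmodule_mul_mk {M P : FinMod k Λ} {A B : Submodule Λ M} (hle : A ≤ B)
    (h : Module.Projective Λ ((M.subquotient A B).tensor P)) :
    K0.mk (M.ofSubmodule B) * K0.mk P =
      K0.mk (M.ofSubmodule A) * K0.mk P + K0.mk (M.subquotient A B) * K0.mk P := by
  have hex : Function.Exact (Submodule.inclusion hle) (A.comap B.subtype).mkQ :=
    LinearMap.exact_iff.mpr (by rw [Submodule.range_inclusion, Submodule.ker_mkQ])
  let i : M.ofSubmodule A →ₗ[Λ] M.ofSubmodule B := Submodule.inclusion hle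
  let q : M.ofSubmodule B →ₗ[Λ] M.subquotient A B := (A.comap B.subtype).mkQ
  obtain ⟨e⟩ := FinMod.nonempty_tensor_equiv_prod_of_exact P i q
    (Submodule.inclusion_injective hle) hex (A.comap B.subtype).mkQ_surjective h
  simp only [← mk_tensor]
  rw [mk_congr e, mk_prod]

/-- If the composition factors of `M` become projective when tensored with `P`, then `M ⊗ P` is
the direct sum of these tensor products. -/
lemma mk_mul_mk_eq_sum (M P : FinMod k Λ)
    (h : ∀ i, Module.Projective Λ ((factor M i).tensor P)) :
    K0.mk M * K0.mk P = ∑ i, K0.mk (factor M i) * K0.mk P := by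
  let s := compositionSeries M
  have hs : s.head = ⊥ ∧ s.last = ⊤ := (exists_compositionSeries M).choose_spec
  let f : Fin (s.length + 1) → K0 k Λ := fun i => K0.mk (M.ofSubmodule (s i)) * K0.mk P
  have hstep : ∀ i : Fin s.length,
      f i.succ = f i.castSucc + K0.mk (factor M i) * K0.mk P := by
    intro i
    have hle : s i.castSucc ≤ s i.succ := (s.step i).le
    exact mk_ofSubmodule_mul_mk hle (h i)
  have h0 : f 0 = 0 := by
    have : Subsingleton (M.ofSubmodule (s 0)) := by
      have : s 0 = ⊥ := hs.1
      rw [this]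
      exact inferInstanceAs (Subsingleton (⊥ : Submodule Λ M))
    simp only [f]
    rw [mk_eq_zero, zero_mul]
  have h1 : f (Fin.last _) = K0.mk M * K0.mk P := by
    have : s (Fin.last _) = ⊤ := hs.2
    simp only [f]
    rw [this]
    exact congrArg (· * K0.mk P) (mk_congr (M := M.ofSubmodule ⊤) Submodule.topEquiv)
  -- Telescoping: the sum of all `f i` is written once with its first and once with its last term
  -- split off, and `hstep` compares the rest.
  have hsum := (Fin.sum_univ_succ f).symm.trans (Fin.sum_univ_castSucc f)
  rw [h0, zero_add, h1, Finset.sum_congr rfl fun i _ => hstep i, Finset.sum_add_distrib,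
    add_right_inj] at hsum
  exact hsum.symm

end K0

/-- The class of a semisimple module is a sum of classes of simple modules. -/
lemma mk_mem_of_isSemisimpleModule {H : AddSubgroup (K0 k Λ)}
    (hH : ∀ S : FinMod k Λ, IsSimpleModule Λ S → K0.mk S ∈ H)
    (Q : FinMod k Λ) (hQ : IsSemisimpleModule Λ Q) : K0.mk Q ∈ H := by
  induction hn : Module.finrank k Q using Nat.strong_induction_on generalizing Q with
  | _ n ih =>
    rcases subsingleton_or_nontrivial Q with h | h
    · rw [K0.mk_eq_zero]; exact zero_mem _
    · obtain ⟨S, hS, f, hf⟩ := exists_surjective_isSimpleModule Q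
      obtain ⟨l, hl⟩ := IsSemisimpleModule.lifting_property f hf LinearMap.id
      obtain ⟨N, ⟨e⟩⟩ := exists_equiv_prod f l hl
      have := IsSimpleModule.nontrivial Λ S
      have hpos : 0 < Module.finrank k S := Module.finrank_pos
      have hN : IsSemisimpleModule Λ N := IsSemisimpleModule.of_injective
        (e.symm.toLinearMap ∘ₗ LinearMap.inl Λ N S)
        (e.symm.injective.comp LinearMap.inl_injective)
      rw [K0.mk_congr e, K0.mk_prod]
      exact add_mem (ih _ (by rw [← hn, FinMod.finrank_congr e, FinMod.finrank_prod]; omega)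
        N hN rfl) (hH S hS)

section Simple

variable [Module.Finite k Λ]

/-- The class of a projective module is a sum of classes of projective covers of simple
modules. -/
lemma mk_mem_of_projective {H : AddSubgroup (K0 k Λ)}
    (hH : ∀ S : FinMod k Λ, IsSimpleModule Λ S → K0.mk (projectiveCover S) ∈ H)
    (Q : FinMod k Λ) (hQ : Module.Projective Λ Q) : K0.mk Q ∈ H := by
  induction hn : Module.finrank k Q using Nat.strong_induction_on generalizing Q with
  | _ n ih =>
    rcases subsingleton_or_nontrivial Q with h | h
    · rw [K0.mk_eq_zero]; exact zero_mem _
    · obtain ⟨S, hS, f, hf⟩ := exists_surjective_isSimpleModule Q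
      obtain ⟨N, hN, ⟨e⟩⟩ :=
        (isProjectiveCover_projectiveCover S).exists_equiv_prod hQ f hf
      have := IsSimpleModule.nontrivial Λ S
      obtain ⟨ψ, hψ⟩ := exists_projectiveCover_surjective S
      have := hψ.nontrivial
      have hpos : 0 < Module.finrank k (projectiveCover S) := Module.finrank_pos
      rw [K0.mk_congr e, K0.mk_prod]
      exact add_mem (ih _ (by rw [← hn, FinMod.finrank_congr e, FinMod.finrank_prod]; omega)
        N hN rfl) (hH S hS)

end Simple

end ProjClass

namespace ProjClass

variable {k Λ : Type u} [Field k] [Ring Λ] [HopfAlgebra k Λ]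

/-! ### The projective class ring: relations and basis -/

section StructureGroup

variable [Module.Finite k Λ]

variable (k Λ) in
/-- The class of the projective cover of the trivial module. -/
noncomputable def projOne : K0p k Λ :=
  ⟨K0.mk (projectiveCover (FinMod.trivial k Λ)),
    Subring.subset_closure ⟨_, Or.inl (projective_projectiveCover _), rfl⟩⟩

lemma coe_projOne :
    (projOne k Λ : K0 k Λ) = K0.mk (projectiveCover (FinMod.trivial k Λ)) := rfl

/-- A finite dimensional basic algebra has finitely many simple modules. -/
lemma finite_structureGroup [IsBasic k Λ] : Finite (StructureGroup k Λ) := by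
  have : IsArtinianRing Λ := IsArtinianRing.of_finite k Λ
  have : IsNoetherianRing Λ := isNoetherian_of_tower k inferInstance
  choose S hS hcls using fun g : StructureGroup k Λ => g.2
  have e := fun g => (IsBasic.multiplicity_one (k := k) (S g) (hS g)).some
  -- A Noetherian module has finitely many isotypic components. Since `Λ` is basic, the component of
  -- a simple module is isomorphic to that module and so determines its class.
  let F : StructureGroup k Λ → isotypicComponents Λ (Λ ⧸ Ring.jacobson Λ) := fun g =>
    ⟨isotypicComponent Λ (Λ ⧸ Ring.jacobson Λ) (S g),
      isotypicComponent Λ (Λ ⧸ Ring.jacobson Λ) (S g),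
      have := hS g
      IsSimpleModule.congr (e g), (e g).isotypicComponent_eq.symm⟩
  refine Finite.of_injective F fun g h hgh => ?_
  have heq : isotypicComponent Λ (Λ ⧸ Ring.jacobson Λ) (S g) =
      isotypicComponent Λ (Λ ⧸ Ring.jacobson Λ) (S h) := congrArg Subtype.val hgh
  refine Subtype.ext ?_
  rw [← hcls g, ← hcls h]
  exact cls_eq k Λ ⟨(e g).symm.trans ((LinearEquiv.ofEq _ _ heq).trans (e h))⟩

variable [IsSplit k Λ] [IsBasic k Λ]

/-- The factors of the composition series of a module, as elements of the structure group. -/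
noncomputable def factorClass (M : FinMod k Λ) (i : Fin (compositionSeries M).length) :
    StructureGroup k Λ :=
  ⟨cls (factor M i), factor M i, isSimpleModule_factor M i, rfl⟩

lemma lift_compositionClass {A : Type*} [Ring A] [Algebra ℤ A] (F : StructureGroup k Λ →* A)
    (M : FinMod k Λ) : MonoidAlgebra.lift ℤ A (StructureGroup k Λ) F (compositionClass M) =
      ∑ i, F (factorClass M i) :=
  (map_sum (MonoidAlgebra.lift ℤ A (StructureGroup k Λ) F)
    (fun i => MonoidAlgebra.of ℤ (StructureGroup k Λ) (factorClass M i)) Finset.univ).trans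
    (Finset.sum_congr rfl fun _ _ => MonoidAlgebra.lift_of _ _)

/-- The trivial character does not vanish at the class of a nonzero module. -/
lemma charValue_one_compositionClass_ne_zero (M : FinMod k Λ) [Nontrivial M] :
    charValue 1 (compositionClass M) ≠ 0 := by
  have hlen : (compositionSeries M).length ≠ 0 := by
    intro h0
    obtain ⟨hb, ht⟩ := (exists_compositionSeries M).choose_spec
    have : RelSeries.head (compositionSeries M) = RelSeries.last (compositionSeries M) :=
      congrArg (compositionSeries M) (Fin.ext (by simp [h0]))
    exact bot_ne_top (hb.symm.trans (this.trans ht))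
  have : charValue 1 (compositionClass M) = (compositionSeries M).length := by
    rw [charValue, lift_compositionClass]
    simp
  rw [this]
  exact_mod_cast hlen

instance (S : FinMod k Λ) [Nontrivial S] : Nontrivial (projectiveCover S) :=
  have ⟨_, hψ⟩ := exists_projectiveCover_surjective S
  hψ.nontrivial

/-- The trivial character is a witness. Finiteness of the set of characters is needed because
`Nat.card` of an infinite type is `0`. -/
lemma numNonvanishing_pos [Finite (StructureGroup k Λ →* ℂˣ)] : 0 < numNonvanishing k Λ := by
  have : Nontrivial (FinMod.trivial k Λ) :=
    Module.nontrivial_of_finrank_pos (R := k) (by rw [FinMod.finrank_trivial]; exact one_pos)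
  have : Nonempty {χ : StructureGroup k Λ →* ℂˣ // charValue χ (canonicalElement k Λ) ≠ 0} :=
    ⟨1, charValue_one_compositionClass_ne_zero _⟩
  exact Nat.card_pos

variable (k Λ) in
/-- The classes of the simple modules in the projective class ring. -/
def simpleClass : StructureGroup k Λ →* K0p k Λ where
  toFun g := ⟨K0.ofClass k Λ g.1, by
    obtain ⟨_, S, hS, rfl⟩ := g
    exact Subring.subset_closure ⟨S, Or.inr inferInstance, rfl⟩⟩
  map_one' := Subtype.ext (map_one (K0.ofClass k Λ))
  map_mul' g h := Subtype.ext (map_mul (K0.ofClass k Λ) g.1 h.1)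

lemma coe_simpleClass {g : StructureGroup k Λ} {S : FinMod k Λ} (h : cls S = g.1) :
    (simpleClass k Λ g : K0 k Λ) = K0.mk S := by
  rw [← K0.ofClass_cls, h]
  rfl

lemma coe_simpleClass_mul_projOne {g : StructureGroup k Λ} {S : FinMod k Λ}
    (hS : IsSimpleModule Λ S) (h : cls S = g.1) :
    ((simpleClass k Λ g * projOne k Λ : K0p k Λ) : K0 k Λ) = K0.mk (projectiveCover S) := by
  rw [Subring.coe_mul, coe_simpleClass h, coe_projOne, ← K0.ofClass_cls, ← K0.ofClass_cls,
    ← map_mul, cls_simple_mul_projectiveCover_trivial hS, K0.ofClass_cls]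

/-- Both $P_1\otimes S$ and $S\otimes P_1$ are the projective cover of $S$. The commutativity of the
structure group plays no role here. -/
lemma projOne_mul_simpleClass (g : StructureGroup k Λ) :
    projOne k Λ * simpleClass k Λ g = simpleClass k Λ g * projOne k Λ := by
  obtain ⟨S, hS, h⟩ := g.2
  refine Subtype.ext ?_
  rw [coe_simpleClass_mul_projOne hS h, Subring.coe_mul, coe_simpleClass h, coe_projOne,
    ← K0.ofClass_cls, ← K0.ofClass_cls, ← map_mul, cls_projectiveCover_trivial_mul_simple hS,
    K0.ofClass_cls]

/-- The left factor is filtered by a composition series of $P_1$, whose factors give $c$. Each of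
them becomes projective after tensoring with the right factor, so the filtration splits. -/
lemma projOne_mul_projOne : projOne k Λ * projOne k Λ =
    MonoidAlgebra.lift ℤ (K0p k Λ) (StructureGroup k Λ) (simpleClass k Λ)
      (canonicalElement k Λ) * projOne k Λ := by
  rw [canonicalElement, lift_compositionClass, Finset.sum_mul]
  refine Subtype.ext ?_
  rw [AddSubmonoidClass.coe_finsetSum]
  refine (K0.mk_mul_mk_eq_sum _ _ fun i => ?_).trans (Finset.sum_congr rfl fun i _ => rfl)
  exact projective_simple_tensor (isSimpleModule_factor _ i) (projective_projectiveCover _)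

/-- The elements of the basis of the projective class ring: the classes of the simple modules and
of their projective covers. -/
noncomputable def basisFun : StructureGroup k Λ ⊕ StructureGroup k Λ → K0p k Λ :=
  Sum.elim (simpleClass k Λ) fun g => simpleClass k Λ g * projOne k Λ

/-- The invariants form a triangular system: `radMult` vanishes on the simple classes and reads off
the coefficients of the projective covers, after which `homMult` reads off those of the simple
modules. This replaces an appeal to Krull–Schmidt. The hypothesis `hns` enters only through `hradP`.
-/
lemma linearIndependent_basisFun (hns : ¬ IsSemisimpleRing Λ) :
    LinearIndependent ℤ (basisFun (k := k) (Λ := Λ)) := by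
  classical
  have := finite_structureGroup (k := k) (Λ := Λ)
  let := Fintype.ofFinite (StructureGroup k Λ)
  choose S hS hcls using fun g : StructureGroup k Λ => g.2
  have hne : ∀ {g h}, g ≠ h → ¬ Nonempty (S g ≃ₗ[Λ] S h) := fun {g h} hgh he =>
    hgh (Subtype.ext (by rw [← hcls g, ← hcls h]; exact cls_eq k Λ he))
  have hP := fun g => isProjectiveCover_projectiveCover (S g)
  have hhomS : ∀ g h, K0.homMult (S h) (simpleClass k Λ g) = if g = h then 1 else 0 := by
    intro g h
    rw [coe_simpleClass (hcls g), K0.homMult_mk]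
    split_ifs with hgh
    · rw [hgh, finrank_homSubmodule_self (hS h), Nat.cast_one]
    · rw [homSubmodule_eq_bot_of_not_equiv (hS g) (hS h) (hne hgh), finrank_bot, Nat.cast_zero]
  have hhomP : ∀ g h, Module.finrank k (homSubmodule (projectiveCover (S g)) (S h)) =
      if g = h then 1 else 0 := by
    intro g h
    split_ifs with hgh
    · rw [hgh, finrank_homSubmodule_of_isProjectiveCover (hP h) (hS h)]
    · rw [homSubmodule_eq_bot_of_isProjectiveCover (hP g) (hS g) (hS h) (hne hgh), finrank_bot]
  have hradS : ∀ g h, K0.radMult (S h) (simpleClass k Λ g) = 0 := by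
    intro g h
    rw [coe_simpleClass (hcls g), K0.radMult_mk, radSubmodule_simple (hS g) (hS h), finrank_bot,
      Nat.cast_zero]
  have hradP : ∀ g h, K0.radMult (S h) (simpleClass k Λ g * projOne k Λ : K0p k Λ) =
      if g = h then 1 else 0 := by
    intro g h
    rw [coe_simpleClass_mul_projOne (hS g) (hcls g), K0.radMult_mk,
      radSubmodule_of_isProjectiveCover (hP g) (hS h)
        (not_projective_of_isSimpleModule hns (hS h)), hhomP]
    push_cast
    rfl
  rw [Fintype.linearIndependent_iff]
  intro a ha
  have ha' : ∑ g, a (Sum.inl g) • (simpleClass k Λ g : K0 k Λ) +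
      ∑ g, a (Sum.inr g) • ((simpleClass k Λ g * projOne k Λ : K0p k Λ) : K0 k Λ) = 0 := by
    have := congrArg (K0p k Λ).subtype ha
    rw [Fintype.sum_sum_type, map_add, map_sum, map_sum, map_zero] at this
    simpa only [map_zsmul] using! this
  have hr : ∀ h, a (Sum.inr h) = 0 := fun h => by
    have := congrArg (K0.radMult (S h)) ha'
    simpa only [map_add, map_sum, map_zsmul, map_zero, hradS, hradP, smul_zero,
      Finset.sum_const_zero, zero_add, smul_eq_mul, mul_ite, mul_one, mul_zero,
      Finset.sum_ite_eq', Finset.mem_univ, if_true] using this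
  have hl : ∀ h, a (Sum.inl h) = 0 := fun h => by
    have := congrArg (K0.homMult (S h)) ha'
    simpa only [map_add, map_sum, map_zsmul, map_zero, hhomS, hr, zero_smul, smul_eq_mul,
      Finset.sum_const_zero, add_zero, mul_ite, mul_one, mul_zero, Finset.sum_ite_eq',
      Finset.mem_univ, if_true] using this
  rintro (g | g)
  · exact hl g
  · exact hr g

/-- The span contains $1$ and is closed under products by the two relations for `projOne`, so it is
a subring. It contains the generators because projective modules are sums of projective covers and
semisimple modules are sums of simple ones. -/
lemma span_basisFun : Submodule.span ℤ (Set.range (basisFun (k := k) (Λ := Λ))) = ⊤ := by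
  set N := Submodule.span ℤ (Set.range (basisFun (k := k) (Λ := Λ))) with hN
  have hl : ∀ g, simpleClass k Λ g ∈ N := fun g => Submodule.subset_span ⟨Sum.inl g, rfl⟩
  have hr : ∀ g, simpleClass k Λ g * projOne k Λ ∈ N := fun g =>
    Submodule.subset_span ⟨Sum.inr g, rfl⟩
  have hlift : ∀ z, MonoidAlgebra.lift ℤ (K0p k Λ) (StructureGroup k Λ) (simpleClass k Λ) z *
      projOne k Λ ∈ N := by
    intro z
    induction z using MonoidAlgebra.induction_on with
    | of g => rw [MonoidAlgebra.lift_of]; exact hr g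
    | add x y hx hy => rw [map_add, add_mul]; exact add_mem hx hy
    | smul n x hx => rw [map_zsmul, smul_mul_assoc]; exact N.smul_mem n hx
  have hmul : ∀ x ∈ N, ∀ y ∈ N, x * y ∈ N := by
    intro x hx y hy
    have h := Submodule.mul_mem_mul hx hy
    refine (?_ : N * N ≤ N) h
    rw [hN, Submodule.span_mul_span, ← hN, Submodule.span_le]
    rintro _ ⟨_, ⟨g | g, rfl⟩, _, ⟨h | h, rfl⟩, rfl⟩ <;>
      simp only [basisFun, Sum.elim_inl, Sum.elim_inr, SetLike.mem_coe]
    · rw [← map_mul]; exact hl _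
    · rw [← mul_assoc, ← map_mul]; exact hr _
    · rw [mul_assoc, projOne_mul_simpleClass, ← mul_assoc, ← map_mul]; exact hr _
    · rw [mul_assoc, ← mul_assoc (projOne k Λ), projOne_mul_simpleClass, mul_assoc, ← mul_assoc,
        ← map_mul, projOne_mul_projOne, ← mul_assoc, ← MonoidAlgebra.lift_of (R := ℤ)
          (simpleClass k Λ), ← map_mul]
      exact hlift _
  have hone : (1 : K0p k Λ) ∈ N := by rw [← map_one (simpleClass k Λ)]; exact hl 1
  -- The generators and the induction over the closure live in `K0`, so the span is moved there.
  let H : AddSubgroup (K0 k Λ) := N.toAddSubgroup.map (K0p k Λ).subtype.toAddMonoidHom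
  have hH : ∀ x : K0 k Λ, x ∈ K0p k Λ → x ∈ H := by
    intro x hx
    induction hx using Subring.closure_induction with
    | mem x hx =>
      obtain ⟨M, hM | hM, rfl⟩ := hx
      · refine mk_mem_of_projective (fun S hS => ?_) M hM
        exact ⟨_, hr ⟨cls S, S, hS, rfl⟩, coe_simpleClass_mul_projOne hS rfl⟩
      · refine mk_mem_of_isSemisimpleModule (fun S hS => ?_) M hM
        exact ⟨_, hl ⟨cls S, S, hS, rfl⟩, coe_simpleClass rfl⟩
    | zero => exact zero_mem _
    | one => exact ⟨1, hone, rfl⟩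
    | add x y _ _ hx hy => exact add_mem hx hy
    | neg x _ hx => exact neg_mem hx
    | mul x y _ _ hx hy =>
      obtain ⟨x, hx, rfl⟩ := hx
      obtain ⟨y, hy, rfl⟩ := hy
      exact ⟨x * y, hmul x hx y hy, rfl⟩
  rw [eq_top_iff]
  rintro ⟨x, hx⟩ -
  obtain ⟨y, hy, hyx⟩ := hH x hx
  have : y = ⟨x, hx⟩ := Subtype.ext hyx
  exact this ▸ hy

end StructureGroup

end ProjClass

theorem mainTheorem1 (k Λ : Type u) [Field k] [Ring Λ] [HopfAlgebra k Λ] [Module.Finite k Λ]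
    [ProjClass.IsBasic k Λ] [ProjClass.IsSplit k Λ]
    (hns : ¬ IsSemisimpleRing Λ)
    (hab : ∀ x y : ProjClass.StructureGroup k Λ, x * y = y * x)
    (s r : ℕ) (hs : s = Nat.card (ProjClass.StructureGroup k Λ))
    (hr : r = ProjClass.numNonvanishing k Λ) :
    0 < r ∧ r ≤ s ∧
      Nonempty ((ℂ ⊗[ℤ] ProjClass.K0p k Λ) ≃ₐ[ℂ]
        ((Fin (2 * r) → ℂ) × (Fin (s - r) → DualNumber ℂ))) := by
  -- Built on the existing group structure, so that characters and the group ring keep their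
  -- meaning.
  let : CommGroup (ProjClass.StructureGroup k Λ) :=
    { (inferInstance : Group (ProjClass.StructureGroup k Λ)) with mul_comm := hab }
  have := ProjClass.finite_structureGroup (k := k) (Λ := Λ)
  have : Finite (ProjClass.StructureGroup k Λ →* ℂˣ) := ProjClass.finite_characters
  refine ⟨hr ▸ ProjClass.numNonvanishing_pos, ?_, ?_⟩
  · rw [hs, hr]
    exact ProjClass.card_nonvanishing_le (ProjClass.canonicalElement k Λ)
  · let b := Module.Basis.mk (ProjClass.linearIndependent_basisFun (k := k) (Λ := Λ) hns)
      ProjClass.span_basisFun.ge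
    exact ProjClass.nonempty_algEquiv_of_basis (ProjClass.simpleClass k Λ) (ProjClass.projOne k Λ)
      (ProjClass.canonicalElement k Λ) ProjClass.projOne_mul_simpleClass
      ProjClass.projOne_mul_projOne b (fun g => Module.Basis.mk_apply _ _ _)
      (fun g => Module.Basis.mk_apply _ _ _) s r hs hr
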